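/- Let $\overline K$ be an algebraically closed field of characteristic $p$ with $p=0$ or $p>2$. Identify a matrix in $\mathrm{GL}_2(\overline K)$ with its image in $\mathrm{PGL}_2(\overline K)$, and for $G\subseteq \mathrm{PGL}_2(\overline K)$ let $N(G)$ be its normalizer in $\mathrm{PGL}_2(\overline K)$. Let $\zeta_m$ denote a primitive $m$-th root of unity in $\overline K$ (when one exists), and put $i=\zeta_4$, $\epsilon=\zeta_5$, $\omega=\frac{-1+\sqrt5}{2}$, $\overline\omega=\frac{-1-\sqrt5}{2}$. Define the following subgroups of $\mathrm{PGL}_2(\overline K)$, whenever the roots of unity involved exist: $$G_{C_n}=\left\{\begin{pmatrix}\zeta_n^r&0\\0&1\end{pmatrix}:0\le r<n\right\},\qquad G_{D_{2n}}=\left\{\begin{pmatrix}\zeta_n^r&0\\0&1\end{pmatrix},\begin{pmatrix}0&\zeta_n^r\\1&0\end{pmatrix}:0\le r<n\right\},$$ $$G_{V_4}=\left\{\begin{pmatrix}\pm1&0\\0&1\end{pmatrix},\begin{pmatrix}0&\pm1\\1&0\end{pmatrix}\right\},$$ $$G_{A_4}=G_{V_4}\cup\left\{\begin{pmatrix}i^\nu&i^\nu\\1&-1\end{pmatrix},\begin{pmatrix}i^\nu&-i^\nu\\1&1\end{pmatrix},\begin{pmatrix}1&i^\nu\\1&-i^\nu\end{pmatrix},\begin{pmatrix}-1&-i^\nu\\1&-i^\nu\end{pmatrix}:\nu=1,3\right\},$$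 $$G_{S_4}=\left\{\begin{pmatrix}i^\nu&0\\0&1\end{pmatrix},\begin{pmatrix}0&i^\nu\\1&0\end{pmatrix},\begin{pmatrix}i^\nu&-i^{\nu+\nu'}\\1&i^{\nu'}\end{pmatrix}:\nu,\nu'=0,1,2,3\right\},$$ $$G_{A_5}=\left\{\begin{pmatrix}\epsilon^r&0\\0&1\end{pmatrix},\begin{pmatrix}0&\epsilon^r\\-1&0\end{pmatrix},\begin{pmatrix}\epsilon^r\omega&\epsilon^{r-s}\\1&-\epsilon^{-s}\omega\end{pmatrix},\begin{pmatrix}\epsilon^r\overline\omega&\epsilon^{r-s}\\1&-\epsilon^{-s}\overline\omega\end{pmatrix}:r,s=0,1,2,3,4\right\}.$$ If $p>2$ and $r\ge1$, regard $\mathrm{PSL}_2(\mathbb F_{p^r})\subseteq\mathrm{PGL}_2(\mathbb F_{p^r})$ as subgroups of $\mathrm{PGL}_2(\overline K)$ via an embedding $\mathbb F_{p^r}\hookrightarrow\overline K$. Then, for every choice of the roots of unity and of $\sqrt5$: (a) $N(G_{C_n})=\left\{\begin{pmatrix}\alpha&0\\0&1\end{pmatrix},\begin{pmatrix}0&\alpha\\1&0\end{pmatrix}:\alpha\in\overline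 K^*\right\}$ if $n>1$; (b) $N(G_{D_{2n}})=G_{D_{4n}}$ if $n>2$, where $G_{D_{4n}}$ is formed with a primitive $2n$-th root of unity; (c) $N(G_{V_4})=G_{S_4}$; (d) $N(G_{A_4})=G_{S_4}$; (e) $N(G_{S_4})=G_{S_4}$; (f) $N(G_{A_5})=G_{A_5}$; (g) $N(\mathrm{PSL}_2(\mathbb F_{p^r}))=\mathrm{PGL}_2(\mathbb F_{p^r})$; (h) $N(\mathrm{PGL}_2(\mathbb F_{p^r}))=\mathrm{PGL}_2(\mathbb F_{p^r})$. -/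

import Mathlib

open scoped MatrixGroups

namespace PGLTwo

variable {K : Type*} [Field K]

/-- The set of classes in `PGL(2, K)` of the (invertible) matrices belonging to `S`:
a matrix in `GL(2, K)` is identified with its image in `PGL(2, K)`. -/
def classes (S : Set (Matrix (Fin 2) (Fin 2) K)) : Set PGL(2, K) :=
  {g | ∃ M : GL (Fin 2) K,
    (M : Matrix (Fin 2) (Fin 2) K) ∈ S ∧ Matrix.ProjGenLinGroup.mk M = g}

/-- The diagonal and antidiagonal elements of `PGL(2, K)`. -/
def monomialGroup (K : Type*) [Field K] : Set PGL(2, K) :=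
  classes {M | ∃ α : K, α ≠ 0 ∧ (M = !![α, 0; 0, 1] ∨ M = !![0, α; 1, 0])}

/-- `G_{C_n}`; here `ζ` is a primitive `n`-th root of unity. -/
def cyclicGroup (ζ : K) (n : ℕ) : Set PGL(2, K) :=
  classes {M | ∃ r : ℕ, r < n ∧ M = !![ζ ^ r, 0; 0, 1]}

/-- `G_{D_{2n}}`, of order `2n`; here `ζ` is a primitive `n`-th root of unity. -/
def dihedralGroup (ζ : K) (n : ℕ) : Set PGL(2, K) :=
  classes {M | ∃ r : ℕ, r < n ∧ (M = !![ζ ^ r, 0; 0, 1] ∨ M = !![0, ζ ^ r; 1, 0])}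

/-- `G_{V_4}`. -/
def kleinFour (K : Type*) [Field K] : Set PGL(2, K) :=
  classes {!![1, 0; 0, 1], !![-1, 0; 0, 1], !![0, 1; 1, 0], !![0, -1; 1, 0]}

/-- `G_{A_4}`; here `i` is a primitive fourth root of unity. -/
def tetrahedral (i : K) : Set PGL(2, K) :=
  kleinFour K ∪
  classes {M | ∃ ν : ℕ, (ν = 1 ∨ ν = 3) ∧
    (M = !![i ^ ν, i ^ ν; 1, -1] ∨ M = !![i ^ ν, -i ^ ν; 1, 1] ∨
     M = !![1, i ^ ν; 1, -i ^ ν] ∨ M = !![-1, -i ^ ν; 1, -i ^ ν])}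

/-- `G_{S_4}`; here `i` is a primitive fourth root of unity. -/
def octahedral (i : K) : Set PGL(2, K) :=
  classes {M | ∃ ν ν' : ℕ, ν < 4 ∧ ν' < 4 ∧
    (M = !![i ^ ν, 0; 0, 1] ∨ M = !![0, i ^ ν; 1, 0] ∨
     M = !![i ^ ν, -i ^ (ν + ν'); 1, i ^ ν'])}

/-- `G_{A_5}`; here `ε` is a primitive fifth root of unity and `s` is a square root of `5`,
so that the two values of `w` are `ω = (-1 + √5) / 2` and its conjugate `(-1 - √5) / 2`. -/
def icosahedral (ε s : K) : Set PGL(2, K) :=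
  classes {M | ∃ r t : ℕ, r < 5 ∧ t < 5 ∧
    (M = !![ε ^ r, 0; 0, 1] ∨ M = !![0, ε ^ r; -1, 0] ∨
     ∃ w : K, (w = (-1 + s) / 2 ∨ w = (-1 - s) / 2) ∧
      M = !![ε ^ r * w, ε ^ ((r : ℤ) - (t : ℤ)); 1, -(ε ^ (-(t : ℤ)) * w)])}

/-- The subgroup `PGL(2, F)` of `PGL(2, K)`, for a field embedding `φ : F → K`. -/
def pglOver {F : Type*} [Field F] (φ : F →+* K) : Subgroup PGL(2, K) :=
  (Matrix.ProjGenLinGroup.map (n := Fin 2) φ).range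

/-- The subgroup `PSL(2, F)` of `PGL(2, K)`, for a field embedding `φ : F → K`. -/
def pslOver {F : Type*} [Field F] (φ : F →+* K) : Subgroup PGL(2, K) :=
  ((Matrix.ProjGenLinGroup.map (n := Fin 2) φ).comp
    Matrix.ProjectiveSpecialLinearGroup.toPGL).range

end PGLTwo

/-!
Elements of `PGL(2, K)` are represented by matrices up to scaling (`ofEntries`). Each of the finite
groups is described by homogeneous equations between the entries (`mem_cyclicGroup`,
`mem_dihedralGroup`, `mem_kleinFour`, `mem_tetrahedral`, `mem_octahedral`), so that statements
about conjugates become polynomial identities.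

* For `G_{C_n}` and `G_{D_{2n}}`, a matrix conjugating a nonscalar diagonal matrix to a diagonal one
  is monomial (`monomial_of_conj_diagonal`). A normalizing element must conjugate `diag(ζ, 1)` in
  this way: for the dihedral group because the other elements are traceless, while `ζ ≠ -1`.
  The condition on the conjugate of an antidiagonal involution then fixes the remaining parameter.
* The normalizer of `G_{V_4}` is computed directly from the equations. The group `G_{V_4}` is
  characteristic both in `G_{A_4}`, where it consists of the solutions of `g ^ 2 = 1`, and in
  `G_{S_4}`, where it consists of the squares that solve `g ^ 2 = 1`; so the normalizers of these
  two groups lie in that of `G_{V_4}`. Conversely `G_{A_4}` is recovered from `G_{V_4}` and its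
  normalizer as the elements whose cube is in `G_{V_4}` (`mem_tetrahedral_iff_octahedral`).
* `G_{A_5}` is the union `B ∪ B T B`, where `B` is dihedral of order ten. Two relations
  for `T D T` with `D` diagonal (`golden_relation`, `golden_relation'`) show that it is a group and
  that its elements of order five are conjugate in it to diagonal ones. After multiplication by an
  element of the group, a normalizing element therefore conjugates `diag(ε, 1)` to a diagonal
  matrix, so it is monomial, and conjugating `T` shows that it belongs to the group.
* For `PSL(2, F)` and `PGL(2, F)`, a normalizing matrix `A` conjugates the two elementary unipotent
  matrices to multiples of matrices over `F`. As the trace `2` is nonzero the multiples are in `F`,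
  and it follows that all products of two entries of `A`, divided by `det A`, are in `F`. Hence `A`
  is a multiple of a matrix over `F` (`mem_pglOver_of_conj`).
-/

/-! ### Matrix representatives of elements of `PGL(2, K)` -/

namespace PGLTwo

variable {K : Type*} [Field K]

/-- The class in `PGL(2, K)` of the matrix with rows `(a, b)` and `(c, d)`. If this matrix is
singular the value is the class of the identity; every lemma about `ofEntries` assumes
`a * d - b * c ≠ 0`. -/
noncomputable def ofEntries (a b c d : K) : PGL(2, K) :=
  open Classical in
  if h : a * d - b * c ≠ 0 then
    Matrix.ProjGenLinGroup.mk
      (Matrix.GeneralLinearGroup.mkOfDetNeZero !![a, b; c, d] (by rwa [Matrix.det_fin_two_of]))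
  else 1

lemma ofEntries_of_ne {a b c d : K} (h : a * d - b * c ≠ 0) :
    ofEntries a b c d = Matrix.ProjGenLinGroup.mk
      (Matrix.GeneralLinearGroup.mkOfDetNeZero !![a, b; c, d]
        (by rwa [Matrix.det_fin_two_of])) :=
  dif_pos h

lemma det_entries_ne_zero (M : GL (Fin 2) K) : M 0 0 * M 1 1 - M 0 1 * M 1 0 ≠ 0 := by
  have h : (M : Matrix (Fin 2) (Fin 2) K).det ≠ 0 := by
    rw [← Matrix.GeneralLinearGroup.val_det_apply]
    exact M.det.ne_zero
  rwa [Matrix.det_fin_two] at h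

lemma mk_eq_ofEntries (M : GL (Fin 2) K) :
    Matrix.ProjGenLinGroup.mk M = ofEntries (M 0 0) (M 0 1) (M 1 0) (M 1 1) := by
  rw [ofEntries_of_ne (det_entries_ne_zero M)]
  congr 1
  ext i j
  fin_cases i <;> fin_cases j <;> rfl

lemma exists_eq_ofEntries (g : PGL(2, K)) :
    ∃ a b c d : K, a * d - b * c ≠ 0 ∧ g = ofEntries a b c d := by
  obtain ⟨M, rfl⟩ := Matrix.ProjGenLinGroup.mk_surjective g
  exact ⟨_, _, _, _, det_entries_ne_zero M, mk_eq_ofEntries M⟩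

lemma ofEntries_one : ofEntries 1 0 0 1 = (1 : PGL(2, K)) := by
  rw [← map_one Matrix.ProjGenLinGroup.mk, mk_eq_ofEntries]
  simp

lemma ofEntries_mul {a b c d a' b' c' d' : K} (h : a * d - b * c ≠ 0)
    (h' : a' * d' - b' * c' ≠ 0) :
    ofEntries a b c d * ofEntries a' b' c' d' =
      ofEntries (a * a' + b * c') (a * b' + b * d') (c * a' + d * c') (c * b' + d * d') := by
  rw [ofEntries_of_ne h, ofEntries_of_ne h', ← map_mul, mk_eq_ofEntries]
  simp [Matrix.GeneralLinearGroup.mkOfDetNeZero]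

lemma ofEntries_eq_iff {a b c d a' b' c' d' : K} (h : a * d - b * c ≠ 0)
    (h' : a' * d' - b' * c' ≠ 0) :
    ofEntries a b c d = ofEntries a' b' c' d' ↔
      ∃ k : K, k ≠ 0 ∧ k * a = a' ∧ k * b = b' ∧ k * c = c' ∧ k * d = d' := by
  rw [ofEntries_of_ne h, ofEntries_of_ne h', Matrix.ProjGenLinGroup.mk_eq_mk_iff]
  have key (u : Kˣ) : Matrix.GeneralLinearGroup.mkOfDetNeZero !![a, b; c, d]
        (by rwa [Matrix.det_fin_two_of]) * .scalar (Fin 2) u =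
      Matrix.GeneralLinearGroup.mkOfDetNeZero !![a', b'; c', d']
        (by rwa [Matrix.det_fin_two_of]) ↔
      u * a = a' ∧ u * b = b' ∧ u * c = c' ∧ u * d = d' := by
    rw [Units.ext_iff, ← Matrix.ext_iff]
    simp [Fin.forall_fin_two, Matrix.GeneralLinearGroup.mkOfDetNeZero, mul_comm, and_assoc]
  simp only [key]
  exact ⟨fun ⟨u, hu⟩ ↦ ⟨u, u.ne_zero, hu⟩, fun ⟨k, hk, hu⟩ ↦ ⟨Units.mk0 k hk, hu⟩⟩

lemma ofEntries_eq_of_smul {a b c d a' b' c' d' : K} (k : K) (hk : k ≠ 0)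
    (h : a * d - b * c ≠ 0) (ha : k * a = a') (hb : k * b = b') (hc : k * c = c')
    (hd : k * d = d') : ofEntries a b c d = ofEntries a' b' c' d' := by
  refine (ofEntries_eq_iff h ?_).2 ⟨k, hk, ha, hb, hc, hd⟩
  rw [← ha, ← hb, ← hc, ← hd]
  convert mul_ne_zero (mul_ne_zero hk hk) h using 1
  ring

lemma ofEntries_inv {a b c d : K} (h : a * d - b * c ≠ 0) :
    (ofEntries a b c d)⁻¹ = ofEntries d (-b) (-c) a := by
  have h' : d * a - -b * -c ≠ 0 := by convert h using 1; ring
  rw [inv_eq_iff_mul_eq_one, ofEntries_mul h h', ← ofEntries_one]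
  symm
  refine ofEntries_eq_of_smul (a * d - b * c) h (by simp) ?_ ?_ ?_ ?_ <;> ring

/-- Conjugation, written with the adjugate in place of the inverse. -/
lemma ofEntries_conj {a b c d x y z w : K} (h : a * d - b * c ≠ 0) (h' : x * w - y * z ≠ 0) :
    ofEntries a b c d * ofEntries x y z w * (ofEntries a b c d)⁻¹ =
      ofEntries ((a * x + b * z) * d - (a * y + b * w) * c)
        ((a * y + b * w) * a - (a * x + b * z) * b)
        ((c * x + d * z) * d - (c * y + d * w) * c)
        ((c * y + d * w) * a - (c * x + d * z) * b) := by
  have h1 : (a * x + b * z) * (c * y + d * w) - (a * y + b * w) * (c * x + d * z) ≠ 0 := by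
    convert mul_ne_zero h h' using 1; ring
  have h2 : d * a - -b * -c ≠ 0 := by convert h using 1; ring
  rw [ofEntries_inv h, ofEntries_mul h h', ofEntries_mul h1 h2]
  congr 1 <;> ring

lemma conj_det_ne_zero {a b c d x y z w : K} (h : a * d - b * c ≠ 0) (h' : x * w - y * z ≠ 0) :
    ((a * x + b * z) * d - (a * y + b * w) * c) * ((c * y + d * w) * a - (c * x + d * z) * b) -
      ((a * y + b * w) * a - (a * x + b * z) * b) *
        ((c * x + d * z) * d - (c * y + d * w) * c) ≠ 0 := by
  convert mul_ne_zero (mul_ne_zero h h) h' using 1; ring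

lemma ofEntries_mem_classes {a b c d : K} (h : a * d - b * c ≠ 0)
    {S : Set (Matrix (Fin 2) (Fin 2) K)} :
    ofEntries a b c d ∈ classes S ↔ ∃ k : K, k ≠ 0 ∧ !![k * a, k * b; k * c, k * d] ∈ S := by
  constructor
  · rintro ⟨M, hM, hMg⟩
    rw [mk_eq_ofEntries, eq_comm, ofEntries_eq_iff h (det_entries_ne_zero M)] at hMg
    obtain ⟨k, hk, h1, h2, h3, h4⟩ := hMg
    refine ⟨k, hk, ?_⟩
    rw [h1, h2, h3, h4]
    convert hM using 1
    exact (Matrix.eta_fin_two _).symm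
  · rintro ⟨k, hk, hS⟩
    have h' : (!![k * a, k * b; k * c, k * d]).det ≠ 0 := by
      rw [Matrix.det_fin_two_of]
      convert mul_ne_zero (mul_ne_zero hk hk) h using 1
      ring
    refine ⟨Matrix.GeneralLinearGroup.mkOfDetNeZero _ h', hS, ?_⟩
    rw [mk_eq_ofEntries]
    symm
    exact ofEntries_eq_of_smul k hk h rfl rfl rfl rfl

lemma ofEntries_sq {a b c d : K} (h : a * d - b * c ≠ 0) :
    ofEntries a b c d ^ 2 =
      ofEntries (a * a + b * c) (a * b + b * d) (c * a + d * c) (c * b + d * d) := by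
  rw [pow_two, ofEntries_mul h h]

lemma sq_det_ne_zero {a b c d : K} (h : a * d - b * c ≠ 0) :
    (a * a + b * c) * (c * b + d * d) - (a * b + b * d) * (c * a + d * c) ≠ 0 := by
  convert mul_ne_zero h h using 1; ring

/-- A class is an involution or trivial exactly when its matrices are traceless or scalar. -/
lemma ofEntries_sq_eq_one_iff {a b c d : K} (h : a * d - b * c ≠ 0) :
    ofEntries a b c d ^ 2 = 1 ↔ a + d = 0 ∨ (b = 0 ∧ c = 0 ∧ a = d) := by
  rw [ofEntries_sq h, ← ofEntries_one, ofEntries_eq_iff (sq_det_ne_zero h) (by simp)]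
  constructor
  · rintro ⟨k, hk, h1, h2, h3, h4⟩
    by_cases ht : a + d = 0
    · exact Or.inl ht
    right
    refine ⟨?_, ?_, ?_⟩
    · exact (mul_eq_zero.1 (by linear_combination h2 : k * (a + d) * b = 0)).resolve_left
        (mul_ne_zero hk ht)
    · exact (mul_eq_zero.1 (by linear_combination h3 : k * (a + d) * c = 0)).resolve_left
        (mul_ne_zero hk ht)
    · exact sub_eq_zero.1 ((mul_eq_zero.1 (by linear_combination h1 - h4 :
        k * (a + d) * (a - d) = 0)).resolve_left (mul_ne_zero hk ht))
  · rintro (ht | ⟨rfl, rfl, rfl⟩)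
    · obtain rfl : d = -a := by linear_combination ht
      have h' : a * a + b * c ≠ 0 := fun h0 ↦ h (by linear_combination -h0)
      refine ⟨(a * a + b * c)⁻¹, inv_ne_zero h', inv_mul_cancel₀ h', ?_, ?_, ?_⟩
      · ring
      · ring
      · rw [← inv_mul_cancel₀ h']; ring
    · have h' : a * a ≠ 0 := by simpa using h
      refine ⟨(a * a)⁻¹, inv_ne_zero h', ?_, by ring, by ring, ?_⟩
      · rw [mul_zero, add_zero, inv_mul_cancel₀ h']
      · rw [mul_zero, zero_add, inv_mul_cancel₀ h']

/-- A set of group elements that is stable under inversion lies in the normalizer of `S` as soon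
as conjugation by its elements maps `S` into itself. -/
lemma subset_normalizer {G : Type*} [Group G] {X S : Set G} (hinv : ∀ g ∈ X, g⁻¹ ∈ X)
    (h : ∀ g ∈ X, ∀ s ∈ S, g * s * g⁻¹ ∈ S) :
    X ⊆ (Subgroup.normalizer S : Set G) := by
  intro g hg s
  refine ⟨h g hg s, fun hs ↦ ?_⟩
  simpa [mul_assoc] using h _ (hinv g hg) _ hs

/-! ### The groups described by equations between matrix entries -/

lemma exists_pow_eq_of_pow_eq {ζ x y : K} {n : ℕ} (hn : n ≠ 0) (hζ : IsPrimitiveRoot ζ n)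
    (hy : y ≠ 0) (h : x ^ n = y ^ n) : ∃ r < n, ζ ^ r = x / y := by
  have := NeZero.mk hn
  refine hζ.eq_pow_of_pow_eq_one ?_
  rw [div_pow, h, div_self (pow_ne_zero _ hy)]

lemma primitiveRoot_pow_pow {ζ : K} {n : ℕ} (hζ : IsPrimitiveRoot ζ n) (r : ℕ) :
    (ζ ^ r) ^ n = 1 := by
  rw [pow_right_comm, hζ.pow_eq_one, one_pow]

lemma primitiveRoot_four_sq {i : K} (hi : IsPrimitiveRoot i 4) : i ^ 2 = -1 := by
  have h4 : (i ^ 2 - 1) * (i ^ 2 + 1) = 0 := by linear_combination hi.pow_eq_one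
  rcases mul_eq_zero.1 h4 with h0 | h0
  · exact absurd (sub_eq_zero.1 h0) (hi.pow_ne_one_of_pos_of_lt two_ne_zero (by norm_num))
  · linear_combination h0

lemma mem_monomialGroup {a b c d : K} (h : a * d - b * c ≠ 0) :
    ofEntries a b c d ∈ monomialGroup K ↔ (b = 0 ∧ c = 0) ∨ (a = 0 ∧ d = 0) := by
  rw [monomialGroup, ofEntries_mem_classes h]
  constructor
  · rintro ⟨k, hk, α, hα, h1 | h1⟩
    · left; simpa [hk] using And.intro (congrFun₂ h1 0 1) (congrFun₂ h1 1 0)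
    · right; simpa [hk] using And.intro (congrFun₂ h1 0 0) (congrFun₂ h1 1 1)
  · rintro (⟨rfl, rfl⟩ | ⟨rfl, rfl⟩)
    · have hd : d ≠ 0 := by rintro rfl; simp at h
      have ha : a ≠ 0 := by rintro rfl; simp at h
      exact ⟨d⁻¹, inv_ne_zero hd, d⁻¹ * a, mul_ne_zero (inv_ne_zero hd) ha, Or.inl (by simp [hd])⟩
    · have hc : c ≠ 0 := by rintro rfl; simp at h
      have hb : b ≠ 0 := by rintro rfl; simp at h
      exact ⟨c⁻¹, inv_ne_zero hc, c⁻¹ * b, mul_ne_zero (inv_ne_zero hc) hb, Or.inr (by simp [hc])⟩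

lemma mem_cyclicGroup {ζ : K} {n : ℕ} (hn : n ≠ 0) (hζ : IsPrimitiveRoot ζ n) {a b c d : K}
    (h : a * d - b * c ≠ 0) :
    ofEntries a b c d ∈ cyclicGroup ζ n ↔ b = 0 ∧ c = 0 ∧ a ^ n = d ^ n := by
  rw [cyclicGroup, ofEntries_mem_classes h]
  constructor
  · rintro ⟨k, hk, r, hr, h1⟩
    have e (i j) := congrFun₂ h1 i j
    have h00 : k * a = ζ ^ r := e 0 0
    have h11 : k * d = 1 := e 1 1
    refine ⟨by simpa [hk] using e 0 1, by simpa [hk] using e 1 0, ?_⟩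
    apply mul_left_cancel₀ (pow_ne_zero n hk)
    rw [← mul_pow, ← mul_pow, h00, h11, one_pow, primitiveRoot_pow_pow hζ]
  · rintro ⟨rfl, rfl, had⟩
    have hd : d ≠ 0 := by rintro rfl; simp at h
    obtain ⟨r, hr, he⟩ := exists_pow_eq_of_pow_eq hn hζ hd had
    exact ⟨d⁻¹, inv_ne_zero hd, r, hr, by simp [hd, he, div_eq_inv_mul]⟩

lemma mem_dihedralGroup {ζ : K} {n : ℕ} (hn : n ≠ 0) (hζ : IsPrimitiveRoot ζ n) {a b c d : K}
    (h : a * d - b * c ≠ 0) :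
    ofEntries a b c d ∈ dihedralGroup ζ n ↔
      (b = 0 ∧ c = 0 ∧ a ^ n = d ^ n) ∨ (a = 0 ∧ d = 0 ∧ b ^ n = c ^ n) := by
  rw [dihedralGroup, ofEntries_mem_classes h]
  constructor
  · rintro ⟨k, hk, r, hr, h1 | h1⟩ <;> have e (i j) := congrFun₂ h1 i j
    · have h00 : k * a = ζ ^ r := e 0 0
      have h11 : k * d = 1 := e 1 1
      refine Or.inl ⟨by simpa [hk] using e 0 1, by simpa [hk] using e 1 0, ?_⟩
      apply mul_left_cancel₀ (pow_ne_zero n hk)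
      rw [← mul_pow, ← mul_pow, h00, h11, one_pow, primitiveRoot_pow_pow hζ]
    · have h01 : k * b = ζ ^ r := e 0 1
      have h10 : k * c = 1 := e 1 0
      refine Or.inr ⟨by simpa [hk] using e 0 0, by simpa [hk] using e 1 1, ?_⟩
      apply mul_left_cancel₀ (pow_ne_zero n hk)
      rw [← mul_pow, ← mul_pow, h01, h10, one_pow, primitiveRoot_pow_pow hζ]
  · rintro (⟨rfl, rfl, had⟩ | ⟨rfl, rfl, hbc⟩)
    · have hd : d ≠ 0 := by rintro rfl; simp at h
      obtain ⟨r, hr, he⟩ := exists_pow_eq_of_pow_eq hn hζ hd had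
      exact ⟨d⁻¹, inv_ne_zero hd, r, hr, Or.inl (by simp [hd, he, div_eq_inv_mul])⟩
    · have hc : c ≠ 0 := by rintro rfl; simp at h
      obtain ⟨r, hr, he⟩ := exists_pow_eq_of_pow_eq hn hζ hc hbc
      exact ⟨c⁻¹, inv_ne_zero hc, r, hr, Or.inr (by simp [hc, he, div_eq_inv_mul])⟩

lemma mem_kleinFour {a b c d : K} (h : a * d - b * c ≠ 0) :
    ofEntries a b c d ∈ kleinFour K ↔
      (b = 0 ∧ c = 0 ∧ a ^ 2 = d ^ 2) ∨ (a = 0 ∧ d = 0 ∧ b ^ 2 = c ^ 2) := by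
  rw [kleinFour, ofEntries_mem_classes h]
  constructor
  · rintro ⟨k, hk, h1 | h1 | h1 | h1⟩ <;> have e (i j) := congrFun₂ h1 i j
    all_goals
      have h00 := e 0 0
      have h01 := e 0 1
      have h10 := e 1 0
      have h11 := e 1 1
      simp only [Matrix.of_apply, Matrix.cons_val', Matrix.cons_val_zero, Matrix.cons_val_one,
        Matrix.cons_val_fin_one, mul_eq_zero, hk, false_or] at h00 h01 h10 h11
    · exact Or.inl ⟨h01, h10, by rw [mul_left_cancel₀ hk (h00.trans h11.symm)]⟩
    · refine Or.inl ⟨h01, h10, mul_left_cancel₀ (pow_ne_zero 2 hk) ?_⟩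
      rw [← mul_pow, ← mul_pow, h00, h11]; ring
    · exact Or.inr ⟨h00, h11, by rw [mul_left_cancel₀ hk (h01.trans h10.symm)]⟩
    · refine Or.inr ⟨h00, h11, mul_left_cancel₀ (pow_ne_zero 2 hk) ?_⟩
      rw [← mul_pow, ← mul_pow, h01, h10]; ring
  · rintro (⟨rfl, rfl, had⟩ | ⟨rfl, rfl, hbc⟩)
    · have hd : d ≠ 0 := by rintro rfl; simp at h
      refine ⟨d⁻¹, inv_ne_zero hd, ?_⟩
      rcases sq_eq_sq_iff_eq_or_eq_neg.1 had with rfl | rfl <;> simp [hd]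
    · have hc : c ≠ 0 := by rintro rfl; simp at h
      refine ⟨c⁻¹, inv_ne_zero hc, ?_⟩
      rcases sq_eq_sq_iff_eq_or_eq_neg.1 hbc with rfl | rfl <;> simp [hc]

/-- Since `bc = -ad` in the last case, a class with four nonzero entries lies in `G_{S_4}` exactly
when, after scaling `c` to `1`, the entries `a` and `d` are fourth roots of unity. -/
lemma mem_octahedral {i : K} (hi : IsPrimitiveRoot i 4) {a b c d : K} (h : a * d - b * c ≠ 0) :
    ofEntries a b c d ∈ octahedral i ↔
      (b = 0 ∧ c = 0 ∧ a ^ 4 = d ^ 4) ∨ (a = 0 ∧ d = 0 ∧ b ^ 4 = c ^ 4) ∨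
        (c ≠ 0 ∧ a ^ 4 = c ^ 4 ∧ d ^ 4 = c ^ 4 ∧ b * c = -(a * d)) := by
  rw [octahedral, ofEntries_mem_classes h]
  constructor
  · rintro ⟨k, hk, r, t, hr, ht, h1 | h1 | h1⟩ <;> have e (i j) := congrFun₂ h1 i j
    · have h00 : k * a = i ^ r := e 0 0
      have h11 : k * d = 1 := e 1 1
      refine Or.inl ⟨by simpa [hk] using e 0 1, by simpa [hk] using e 1 0, ?_⟩
      apply mul_left_cancel₀ (pow_ne_zero 4 hk)
      rw [← mul_pow, ← mul_pow, h00, h11, one_pow, primitiveRoot_pow_pow hi]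
    · have h01 : k * b = i ^ r := e 0 1
      have h10 : k * c = 1 := e 1 0
      refine Or.inr (Or.inl ⟨by simpa [hk] using e 0 0, by simpa [hk] using e 1 1, ?_⟩)
      apply mul_left_cancel₀ (pow_ne_zero 4 hk)
      rw [← mul_pow, ← mul_pow, h01, h10, one_pow, primitiveRoot_pow_pow hi]
    · have h00 : k * a = i ^ r := e 0 0
      have h01 : k * b = -i ^ (r + t) := e 0 1
      have h10 : k * c = 1 := e 1 0
      have h11 : k * d = i ^ t := e 1 1
      refine Or.inr (Or.inr ⟨?_, ?_, ?_, ?_⟩)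
      · rintro rfl; simp at h10
      · apply mul_left_cancel₀ (pow_ne_zero 4 hk)
        rw [← mul_pow, ← mul_pow, h00, h10, one_pow, primitiveRoot_pow_pow hi]
      · apply mul_left_cancel₀ (pow_ne_zero 4 hk)
        rw [← mul_pow, ← mul_pow, h11, h10, one_pow, primitiveRoot_pow_pow hi]
      · apply mul_left_cancel₀ (pow_ne_zero 2 hk)
        rw [pow_add, ← h00, ← h11] at h01
        linear_combination k * c * h01 - k * a * k * d * h10
  · rintro (⟨rfl, rfl, had⟩ | ⟨rfl, rfl, hbc⟩ | ⟨hc, hac, hdc, hbc⟩)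
    · have hd : d ≠ 0 := by rintro rfl; simp at h
      obtain ⟨r, hr, he⟩ := exists_pow_eq_of_pow_eq four_ne_zero hi hd had
      exact ⟨d⁻¹, inv_ne_zero hd, r, 0, hr, by simp, Or.inl (by simp [hd, he, div_eq_inv_mul])⟩
    · have hc : c ≠ 0 := by rintro rfl; simp at h
      obtain ⟨r, hr, he⟩ := exists_pow_eq_of_pow_eq four_ne_zero hi hc hbc
      exact ⟨c⁻¹, inv_ne_zero hc, r, 0, hr, by simp,
        Or.inr (Or.inl (by simp [hc, he, div_eq_inv_mul]))⟩
    · obtain ⟨r, hr, he⟩ := exists_pow_eq_of_pow_eq four_ne_zero hi hc hac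
      obtain ⟨t, ht, he'⟩ := exists_pow_eq_of_pow_eq four_ne_zero hi hc hdc
      refine ⟨c⁻¹, inv_ne_zero hc, r, t, hr, ht, Or.inr (Or.inr ?_)⟩
      have hb : c⁻¹ * b = -(a / c * (d / c)) := by
        field_simp
        linear_combination hbc
      rw [pow_add, he, he', inv_mul_cancel₀ hc, hb, ← div_eq_inv_mul, ← div_eq_inv_mul]

/-- In a class of `G_{S_4}` with four nonzero entries, the condition `a ^ 2 = -d ^ 2` is what
singles out the eight elements of order three. -/
lemma mem_tetrahedral {i : K} (hi : IsPrimitiveRoot i 4) {a b c d : K} (h : a * d - b * c ≠ 0) :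
    ofEntries a b c d ∈ tetrahedral i ↔
      (b = 0 ∧ c = 0 ∧ a ^ 2 = d ^ 2) ∨ (a = 0 ∧ d = 0 ∧ b ^ 2 = c ^ 2) ∨
        (c ≠ 0 ∧ a ^ 4 = c ^ 4 ∧ a ^ 2 = -d ^ 2 ∧ b * c = -(a * d)) := by
  have hi2 := primitiveRoot_four_sq hi
  have hi3 : i ^ 3 = -i := by linear_combination i * hi2
  rw [tetrahedral, Set.mem_union, mem_kleinFour h, ofEntries_mem_classes h, or_assoc]
  refine or_congr_right (or_congr_right ?_)
  constructor
  · rintro ⟨k, hk, ν, hν, h1⟩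
    obtain ⟨j, hj, hj2⟩ : ∃ j : K, i ^ ν = j ∧ j ^ 2 = -1 := by
      rcases hν with rfl | rfl
      · exact ⟨i, pow_one i, hi2⟩
      · exact ⟨-i, hi3, by rw [neg_sq, hi2]⟩
    rw [hj] at h1
    have e4 {x y : K} (hx : (k * x) ^ 4 = (k * y) ^ 4) : x ^ 4 = y ^ 4 := by
      apply mul_left_cancel₀ (pow_ne_zero 4 hk)
      rwa [← mul_pow, ← mul_pow]
    have e2 {x y : K} (hx : (k * x) ^ 2 = -(k * y) ^ 2) : x ^ 2 = -y ^ 2 := by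
      apply mul_left_cancel₀ (pow_ne_zero 2 hk)
      linear_combination hx
    have e1 (hx : (k * b) * (k * c) = -((k * a) * (k * d))) : b * c = -(a * d) := by
      apply mul_left_cancel₀ (pow_ne_zero 2 hk)
      linear_combination hx
    rcases h1 with h1 | h1 | h1 | h1 <;>
    · have h00 := congrFun₂ h1 0 0
      have h01 := congrFun₂ h1 0 1
      have h10 := congrFun₂ h1 1 0
      have h11 := congrFun₂ h1 1 1
      simp only [Matrix.of_apply, Matrix.cons_val', Matrix.cons_val_zero, Matrix.cons_val_one,
        Matrix.cons_val_fin_one] at h00 h01 h10 h11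
      refine ⟨?_, e4 ?_, e2 ?_, e1 ?_⟩
      · rintro rfl; simp at h10
      · rw [h00, h10] <;> grind
      · rw [h00, h11]; grind
      · rw [h00, h01, h10, h11]; ring
  · rintro ⟨hc, hac, had, hbc⟩
    have hj (j : K) (hj : j ^ 2 = -1) : ∃ ν : ℕ, (ν = 1 ∨ ν = 3) ∧ i ^ ν = j := by
      rcases sq_eq_sq_iff_eq_or_eq_neg.1 (hj.trans hi2.symm) with rfl | rfl
      · exact ⟨1, Or.inl rfl, pow_one _⟩
      · exact ⟨3, Or.inr rfl, hi3⟩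
    have hb : c⁻¹ * b = -(c⁻¹ * a) * (c⁻¹ * d) := by
      field_simp
      rw [mul_comm, hbc]
    refine ⟨c⁻¹, inv_ne_zero hc, ?_⟩
    rw [hb, inv_mul_cancel₀ hc]
    have hx4 : (c⁻¹ * a) ^ 4 = 1 := by
      rw [mul_pow, hac, inv_pow, inv_mul_cancel₀ (pow_ne_zero 4 hc)]
    have hxy : (c⁻¹ * a) ^ 2 = -(c⁻¹ * d) ^ 2 := by linear_combination c⁻¹ ^ 2 * had
    generalize c⁻¹ * a = x at hx4 hxy
    generalize c⁻¹ * d = y at hxy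
    have hx : (x ^ 2 - 1) * (x ^ 2 + 1) = 0 := by linear_combination hx4
    rcases mul_eq_zero.1 hx with hx | hx
    · have hy2 : (-y) ^ 2 = -1 := by linear_combination hxy - hx
      obtain ⟨ν, hν, hν'⟩ := hj (-y) hy2
      refine ⟨ν, hν, ?_⟩
      rw [hν']
      rcases sq_eq_sq_iff_eq_or_eq_neg.1 ((sub_eq_zero.1 hx).trans (one_pow 2).symm) with rfl | rfl
      · right; right; left; simp
      · right; right; right; simp
    · have hy2 : y ^ 2 = 1 := by linear_combination hxy - hx
      obtain ⟨ν, hν, hν'⟩ := hj x (by linear_combination hx)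
      refine ⟨ν, hν, ?_⟩
      rw [hν']
      rcases sq_eq_sq_iff_eq_or_eq_neg.1 (hy2.trans (one_pow 2).symm) with rfl | rfl
      · right; left; simp
      · left; simp

/-! ### Normalizers of the cyclic and dihedral groups -/

/-- A matrix that conjugates `diag(x, w)`, with `x ≠ w`, to a diagonal matrix permutes the two
eigenlines of `diag(x, w)`. -/
lemma monomial_of_conj_diagonal {a b c d x w : K} (h : a * d - b * c ≠ 0) (hxw : x ≠ w)
    (h1 : (a * 0 + b * w) * a - (a * x + b * 0) * b = 0)
    (h2 : (c * x + d * 0) * d - (c * 0 + d * w) * c = 0) :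
    (b = 0 ∧ c = 0) ∨ (a = 0 ∧ d = 0) := by
  have hab : a * b = 0 := (mul_eq_zero.1 (by linear_combination -h1 :
    (x - w) * (a * b) = 0)).resolve_left (sub_ne_zero.2 hxw)
  have hcd : c * d = 0 := (mul_eq_zero.1 (by linear_combination h2 :
    (x - w) * (c * d) = 0)).resolve_left (sub_ne_zero.2 hxw)
  rcases mul_eq_zero.1 hab with rfl | rfl <;> rcases mul_eq_zero.1 hcd with rfl | rfl <;>
    simp_all

lemma mul_pow_congr {x y x' y' : K} {n : ℕ} (h : x ^ n = y ^ n) (h' : x' ^ n = y' ^ n) :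
    (x * x') ^ n = (y * y') ^ n := by
  rw [mul_pow, mul_pow, h, h']

lemma neg_pow_congr {x y : K} {n : ℕ} (h : x ^ n = y ^ n) : (-x) ^ n = (-y) ^ n := by
  rw [neg_pow, h, ← neg_pow]

lemma normalizer_cyclicGroup {n : ℕ} {ζ : K} (hn : 1 < n) (hζ : IsPrimitiveRoot ζ n) :
    (Subgroup.normalizer (cyclicGroup ζ n) : Set PGL(2, K)) = monomialGroup K := by
  have hn0 : n ≠ 0 := by lia
  have hζ0 : ζ ≠ 0 := hζ.ne_zero hn0
  apply Set.Subset.antisymm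
  · intro g hg
    obtain ⟨a, b, c, d, h, rfl⟩ := exists_eq_ofEntries g
    have hD : ζ * 1 - 0 * 0 ≠ 0 := by simpa using hζ0
    have h1 := (hg (ofEntries ζ 0 0 1)).1
      ((mem_cyclicGroup hn0 hζ hD).2 ⟨rfl, rfl, by rw [hζ.pow_eq_one, one_pow]⟩)
    rw [ofEntries_conj h hD, mem_cyclicGroup hn0 hζ (conj_det_ne_zero h hD)] at h1
    rw [mem_monomialGroup h]
    exact monomial_of_conj_diagonal h (hζ.ne_one hn) h1.1 h1.2.1
  · apply subset_normalizer
    · intro g hg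
      obtain ⟨a, b, c, d, h, rfl⟩ := exists_eq_ofEntries g
      rw [mem_monomialGroup h] at hg
      rw [ofEntries_inv h, mem_monomialGroup (by convert h using 1; ring)]
      simpa [and_comm] using hg
    · intro g hg s hs
      obtain ⟨a, b, c, d, h, rfl⟩ := exists_eq_ofEntries g
      obtain ⟨x, y, z, w, h', rfl⟩ := exists_eq_ofEntries s
      rw [mem_monomialGroup h] at hg
      rw [mem_cyclicGroup hn0 hζ h'] at hs
      rw [ofEntries_conj h h', mem_cyclicGroup hn0 hζ (conj_det_ne_zero h h')]
      obtain ⟨rfl, rfl, hxw⟩ := hs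
      rcases hg with ⟨rfl, rfl⟩ | ⟨rfl, rfl⟩ <;> refine ⟨by ring, by ring, ?_⟩
      · convert mul_pow_congr hxw (rfl : (a * d) ^ n = _) using 2 <;> ring
      · convert mul_pow_congr hxw.symm (rfl : (-(b * c)) ^ n = _) using 2 <;> ring

lemma dihedralGroup_inv_mem {n : ℕ} {ζ : K} (hn : n ≠ 0) (hζ : IsPrimitiveRoot ζ n)
    {g : PGL(2, K)} (hg : g ∈ dihedralGroup ζ n) : g⁻¹ ∈ dihedralGroup ζ n := by
  obtain ⟨a, b, c, d, h, rfl⟩ := exists_eq_ofEntries g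
  rw [mem_dihedralGroup hn hζ h] at hg
  rw [ofEntries_inv h, mem_dihedralGroup hn hζ (by convert h using 1; ring)]
  rcases hg with ⟨rfl, rfl, h1⟩ | ⟨rfl, rfl, h1⟩
  · simp [h1]
  · exact Or.inr ⟨rfl, rfl, neg_pow_congr h1⟩

lemma normalizer_dihedralGroup {n : ℕ} {ζ ξ : K} (hn : 2 < n) (hζ : IsPrimitiveRoot ζ n)
    (hξ : IsPrimitiveRoot ξ (2 * n)) :
    (Subgroup.normalizer (dihedralGroup ζ n) : Set PGL(2, K)) = dihedralGroup ξ (2 * n) := by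
  have hn0 : n ≠ 0 := by lia
  have hn1 : 2 * n ≠ 0 := by lia
  have hζ0 : ζ ≠ 0 := hζ.ne_zero hn0
  apply Set.Subset.antisymm
  · intro g hg
    obtain ⟨a, b, c, d, h, rfl⟩ := exists_eq_ofEntries g
    have hD : ζ * 1 - 0 * 0 ≠ 0 := by simpa using hζ0
    have hJ : (0 : K) * 0 - 1 * 1 ≠ 0 := by simp
    have h1 := (hg (ofEntries ζ 0 0 1)).1
      ((mem_dihedralGroup hn0 hζ hD).2 (Or.inl ⟨rfl, rfl, by rw [hζ.pow_eq_one, one_pow]⟩))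
    have h2 := (hg (ofEntries 0 1 1 0)).1
      ((mem_dihedralGroup hn0 hζ hJ).2 (Or.inr ⟨rfl, rfl, rfl⟩))
    rw [ofEntries_conj h hD, mem_dihedralGroup hn0 hζ (conj_det_ne_zero h hD)] at h1
    rw [ofEntries_conj h hJ, mem_dihedralGroup hn0 hζ (conj_det_ne_zero h hJ)] at h2
    rw [mem_dihedralGroup hn1 hξ h]
    have hmon : (b = 0 ∧ c = 0) ∨ (a = 0 ∧ d = 0) := by
      rcases h1 with ⟨h12, h21, -⟩ | ⟨h11, h22, -⟩
      · exact monomial_of_conj_diagonal h (hζ.ne_one (by lia)) h12 h21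
      · -- The conjugate is traceless, so `ζ = -1`, although `ζ` has order greater than two.
        have hζ1 : ζ + 1 = 0 := (mul_eq_zero.1 (by linear_combination h11 + h22 :
          (a * d - b * c) * (ζ + 1) = 0)).resolve_left h
        refine absurd ?_ (hζ.pow_ne_one_of_pos_of_lt two_ne_zero hn)
        linear_combination (ζ - 1) * hζ1
    rcases hmon with ⟨rfl, rfl⟩ | ⟨rfl, rfl⟩
    · left
      have ha : a ≠ 0 := by rintro rfl; simp at h
      rcases h2 with ⟨h0, -, -⟩ | ⟨-, -, h0⟩
      · exact absurd (by linear_combination h0 : a ^ 2 = 0) (pow_ne_zero 2 ha)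
      · refine ⟨rfl, rfl, ?_⟩
        rw [pow_mul, pow_mul]
        convert h0 using 2 <;> ring
    · right
      have hb : b ≠ 0 := by rintro rfl; simp at h
      rcases h2 with ⟨h0, -, -⟩ | ⟨-, -, h0⟩
      · exact absurd (by linear_combination -h0 : b ^ 2 = 0) (pow_ne_zero 2 hb)
      · refine ⟨rfl, rfl, ?_⟩
        rw [pow_mul, pow_mul]
        convert neg_pow_congr h0 using 2 <;> ring
  · apply subset_normalizer fun g ↦ dihedralGroup_inv_mem hn1 hξ
    intro g hg s hs
    obtain ⟨a, b, c, d, h, rfl⟩ := exists_eq_ofEntries g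
    obtain ⟨x, y, z, w, h', rfl⟩ := exists_eq_ofEntries s
    rw [mem_dihedralGroup hn1 hξ h] at hg
    rw [mem_dihedralGroup hn0 hζ h'] at hs
    rw [ofEntries_conj h h', mem_dihedralGroup hn0 hζ (conj_det_ne_zero h h')]
    simp only [pow_mul] at hg
    rcases hg with ⟨rfl, rfl, hg⟩ | ⟨rfl, rfl, hg⟩ <;>
      rcases hs with ⟨rfl, rfl, hs⟩ | ⟨rfl, rfl, hs⟩
    · refine Or.inl ⟨by ring, by ring, ?_⟩
      convert mul_pow_congr hs (rfl : (a * d) ^ n = _) using 2 <;> ring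
    · refine Or.inr ⟨by ring, by ring, ?_⟩
      convert mul_pow_congr hs hg using 2 <;> ring
    · refine Or.inl ⟨by ring, by ring, ?_⟩
      convert mul_pow_congr hs.symm (rfl : (-(b * c)) ^ n = _) using 2 <;> ring
    · refine Or.inr ⟨by ring, by ring, ?_⟩
      convert mul_pow_congr hs.symm (neg_pow_congr hg) using 2 <;> ring

/-! ### Normalizers of the polyhedral groups `V₄`, `A₄` and `S₄` -/

lemma normalizer_kleinFour (h2 : (2 : K) ≠ 0) {i : K} (hi : IsPrimitiveRoot i 4) :
    (Subgroup.normalizer (kleinFour K) : Set PGL(2, K)) = octahedral i := by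
  apply Set.Subset.antisymm
  · intro g hg
    obtain ⟨a, b, c, d, h, rfl⟩ := exists_eq_ofEntries g
    have hD : (-1 : K) * 1 - 0 * 0 ≠ 0 := by simp
    have hJ : (0 : K) * 0 - 1 * 1 ≠ 0 := by simp
    have h1 := (hg (ofEntries (-1) 0 0 1)).1 ((mem_kleinFour hD).2 (Or.inl ⟨rfl, rfl, by ring⟩))
    have h3 := (hg (ofEntries 0 1 1 0)).1 ((mem_kleinFour hJ).2 (Or.inr ⟨rfl, rfl, rfl⟩))
    rw [ofEntries_conj h hD, mem_kleinFour (conj_det_ne_zero h hD)] at h1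
    rw [ofEntries_conj h hJ, mem_kleinFour (conj_det_ne_zero h hJ)] at h3
    rw [mem_octahedral hi h]
    rcases h1 with ⟨h12, h21, -⟩ | ⟨h11, -, hoff⟩
    · rcases monomial_of_conj_diagonal h (fun h0 ↦ h2 (by linear_combination -h0)) h12 h21 with
        ⟨rfl, rfl⟩ | ⟨rfl, rfl⟩
      · left
        have ha : a ≠ 0 := by rintro rfl; simp at h
        rcases h3 with ⟨h0, -, -⟩ | ⟨-, -, h0⟩
        · exact absurd (by linear_combination h0 : a ^ 2 = 0) (pow_ne_zero 2 ha)
        · exact ⟨rfl, rfl, by linear_combination h0⟩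
      · right; left
        have hb : b ≠ 0 := by rintro rfl; simp at h
        rcases h3 with ⟨h0, -, -⟩ | ⟨-, -, h0⟩
        · exact absurd (by linear_combination -h0 : b ^ 2 = 0) (pow_ne_zero 2 hb)
        · exact ⟨rfl, rfl, by linear_combination h0⟩
    · right; right
      have hbc : b * c = -(a * d) := by linear_combination -h11
      have had : a * d ≠ 0 := fun h0 ↦ h (by linear_combination 2 * h0 - hbc)
      obtain ⟨ha, hd⟩ := mul_ne_zero_iff.1 had
      obtain ⟨hb, hc⟩ := mul_ne_zero_iff.1 (hbc ▸ neg_ne_zero.2 had)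
      have hsq : a ^ 2 * b ^ 2 = c ^ 2 * d ^ 2 := by
        apply mul_left_cancel₀ (pow_ne_zero 2 h2)
        linear_combination hoff
      suffices hX : a ^ 4 = c ^ 4 ∧ d ^ 4 = c ^ 4 from ⟨hc, hX.1, hX.2, hbc⟩
      rcases h3 with ⟨h12, h21, -⟩ | ⟨h11', -, hoff'⟩
      · have hab : a ^ 2 = b ^ 2 := by linear_combination h12
        have hcd : d ^ 2 = c ^ 2 := by linear_combination h21
        exact ⟨by linear_combination hsq + a ^ 2 * hab + c ^ 2 * hcd,
          by linear_combination (d ^ 2 + c ^ 2) * hcd⟩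
      · have hac : b * d = a * c := by linear_combination h11'
        have hdc : d ^ 2 = -c ^ 2 := by
          apply mul_left_cancel₀ ha
          linear_combination d * hbc - c * hac
        have hba : b ^ 2 = -a ^ 2 := by
          apply mul_left_cancel₀ (pow_ne_zero 2 hc)
          linear_combination -(b * d + a * c) * hac + b ^ 2 * hdc
        refine ⟨?_, by linear_combination (d ^ 2 - c ^ 2) * hdc⟩
        linear_combination -hsq + a ^ 2 * hba - c ^ 2 * hdc
  · apply subset_normalizer
    · intro g hg
      obtain ⟨a, b, c, d, h, rfl⟩ := exists_eq_ofEntries g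
      rw [mem_octahedral hi h] at hg
      rw [ofEntries_inv h, mem_octahedral hi (by convert h using 1; ring)]
      rcases hg with ⟨rfl, rfl, h1⟩ | ⟨rfl, rfl, h1⟩ | ⟨hc, h1, h3, h4⟩
      · simp [h1]
      · right; left; simp [h1, Even.neg_pow (show Even 4 by decide)]
      · right; right
        exact ⟨neg_ne_zero.2 hc, by linear_combination h3, by linear_combination h1,
          by linear_combination h4⟩
    · intro g hg s hs
      obtain ⟨a, b, c, d, h, rfl⟩ := exists_eq_ofEntries g
      obtain ⟨x, y, z, w, h', rfl⟩ := exists_eq_ofEntries s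
      rw [mem_octahedral hi h] at hg
      rw [mem_kleinFour h'] at hs
      rw [ofEntries_conj h h', mem_kleinFour (conj_det_ne_zero h h')]
      rcases hg with ⟨rfl, rfl, hg⟩ | ⟨rfl, rfl, hg⟩ | ⟨hc, hac, hdc, hbc⟩
      · rcases hs with ⟨rfl, rfl, hs⟩ | ⟨rfl, rfl, hs⟩
        · left; refine ⟨by ring, by ring, ?_⟩
          linear_combination a ^ 2 * d ^ 2 * hs
        · right; refine ⟨by ring, by ring, ?_⟩
          linear_combination a ^ 4 * hs + z ^ 2 * hg
      · rcases hs with ⟨rfl, rfl, hs⟩ | ⟨rfl, rfl, hs⟩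
        · left; refine ⟨by ring, by ring, ?_⟩
          linear_combination -b ^ 2 * c ^ 2 * hs
        · right; refine ⟨by ring, by ring, ?_⟩
          linear_combination -b ^ 4 * hs + y ^ 2 * hg
      · have hb2 : c ^ 2 * b ^ 2 = a ^ 2 * d ^ 2 := by
          linear_combination (b * c - a * d) * hbc
        have hd2 : d ^ 2 = c ^ 2 ∨ d ^ 2 = -c ^ 2 :=
          sq_eq_sq_iff_eq_or_eq_neg.1 (by linear_combination hdc)
        have hc2 := pow_ne_zero 2 hc
        rcases hs with ⟨rfl, rfl, hs⟩ | ⟨rfl, rfl, hs⟩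
        · rcases sq_eq_sq_iff_eq_or_eq_neg.1 hs with rfl | rfl
          · left; exact ⟨by ring, by ring, by ring⟩
          · right
            refine ⟨by linear_combination -w * hbc, by linear_combination w * hbc, ?_⟩
            apply mul_left_cancel₀ hc2
            linear_combination 4 * w ^ 2 * (a ^ 2 * hb2 + d ^ 2 * hac)
        · rcases hd2 with hd2 | hd2
          · have hb2' : b ^ 2 = a ^ 2 := by
              apply mul_left_cancel₀ hc2
              linear_combination hb2 + a ^ 2 * hd2
            rcases sq_eq_sq_iff_eq_or_eq_neg.1 hs with rfl | rfl
            · left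
              exact ⟨by linear_combination -y * hb2', by linear_combination y * hd2, by ring⟩
            · right
              have h0 : b * d + a * c = 0 := by
                apply (mul_eq_zero.1 (_ : c * (b * d + a * c) = 0)).resolve_left hc
                linear_combination d * hbc - a * hd2
              refine ⟨by linear_combination z * h0, by linear_combination -z * h0, ?_⟩
              linear_combination z ^ 2 * ((b ^ 2 + 3 * a ^ 2) * hb2' -
                (d ^ 2 + 3 * c ^ 2) * hd2 + 4 * hac)
          · have hb2' : b ^ 2 = -a ^ 2 := by
              apply mul_left_cancel₀ hc2
              linear_combination hb2 + a ^ 2 * hd2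
            rcases sq_eq_sq_iff_eq_or_eq_neg.1 hs with rfl | rfl
            · right
              have h0 : b * d - a * c = 0 := by
                apply (mul_eq_zero.1 (_ : c * (b * d - a * c) = 0)).resolve_left hc
                linear_combination d * hbc - a * hd2
              refine ⟨by linear_combination y * h0, by linear_combination -y * h0, ?_⟩
              linear_combination y ^ 2 * ((b ^ 2 - 3 * a ^ 2) * hb2' -
                (d ^ 2 - 3 * c ^ 2) * hd2 + 4 * hac)
            · left
              exact ⟨by linear_combination -z * hb2', by linear_combination z * hd2, by ring⟩

/-- An element of `G_{A_4}` squares to the identity only if it lies in `G_{V_4}`, so that `G_{V_4}`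
is characteristic in `G_{A_4}`. -/
lemma mem_kleinFour_iff_tetrahedral (h2 : (2 : K) ≠ 0) {i : K} (hi : IsPrimitiveRoot i 4)
    (g : PGL(2, K)) : g ∈ kleinFour K ↔ g ∈ tetrahedral i ∧ g ^ 2 = 1 := by
  obtain ⟨a, b, c, d, h, rfl⟩ := exists_eq_ofEntries g
  rw [mem_kleinFour h, mem_tetrahedral hi h, ofEntries_sq_eq_one_iff h]
  constructor
  · rintro (⟨rfl, rfl, h1⟩ | ⟨rfl, rfl, h1⟩)
    · refine ⟨Or.inl ⟨rfl, rfl, h1⟩, ?_⟩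
      rcases sq_eq_sq_iff_eq_or_eq_neg.1 h1 with rfl | rfl
      · exact Or.inr ⟨rfl, rfl, rfl⟩
      · exact Or.inl (by ring)
    · exact ⟨Or.inr (Or.inl ⟨rfl, rfl, h1⟩), Or.inl (by ring)⟩
  · rintro ⟨h1 | h1 | ⟨hc, h1, h3, h4⟩, h5⟩
    · exact Or.inl h1
    · exact Or.inr h1
    · rcases h5 with h5 | ⟨-, h5, -⟩
      · have ha : 2 * a ^ 2 = 0 := by linear_combination h3 + (a - d) * h5
        have ha : a = 0 := by simpa [h2] using ha
        refine absurd ?_ (pow_ne_zero 4 hc)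
        rw [← h1, ha]; ring
      · exact absurd h5 hc

lemma ofEntries_cube {a b c d : K} (h : a * d - b * c ≠ 0) :
    ofEntries a b c d ^ 3 =
      ofEntries ((a * a + b * c) * a + (a * b + b * d) * c)
        ((a * a + b * c) * b + (a * b + b * d) * d)
        ((c * a + d * c) * a + (c * b + d * d) * c)
        ((c * a + d * c) * b + (c * b + d * d) * d) := by
  rw [pow_succ, ofEntries_sq h, ofEntries_mul (sq_det_ne_zero h) h]

/-- `G_{A_4}` consists of the elements of `G_{S_4}` whose image in `G_{S_4} / G_{V_4} ≅ S₃` has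
order dividing three. -/
lemma mem_tetrahedral_iff_octahedral (h2 : (2 : K) ≠ 0) {i : K} (hi : IsPrimitiveRoot i 4)
    (g : PGL(2, K)) : g ∈ tetrahedral i ↔ g ∈ octahedral i ∧ g ^ 3 ∈ kleinFour K := by
  obtain ⟨a, b, c, d, h, rfl⟩ := exists_eq_ofEntries g
  have hdet : ((a * a + b * c) * a + (a * b + b * d) * c) *
      ((c * a + d * c) * b + (c * b + d * d) * d) -
      ((a * a + b * c) * b + (a * b + b * d) * d) *
        ((c * a + d * c) * a + (c * b + d * d) * c) ≠ 0 := by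
    convert pow_ne_zero 3 h using 1; ring
  rw [mem_tetrahedral hi h, mem_octahedral hi h, ofEntries_cube h, mem_kleinFour hdet]
  constructor
  · rintro (⟨rfl, rfl, h1⟩ | ⟨rfl, rfl, h1⟩ | ⟨hc, h1, h3, h4⟩)
    · refine ⟨Or.inl ⟨rfl, rfl, by linear_combination (a ^ 2 + d ^ 2) * h1⟩,
        Or.inl ⟨by ring, by ring, ?_⟩⟩
      linear_combination (a ^ 4 + a ^ 2 * d ^ 2 + d ^ 4) * h1
    · refine ⟨Or.inr (Or.inl ⟨rfl, rfl, by linear_combination (b ^ 2 + c ^ 2) * h1⟩),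
        Or.inr ⟨by ring, by ring, ?_⟩⟩
      linear_combination b ^ 2 * c ^ 2 * h1
    · refine ⟨Or.inr (Or.inr ⟨hc, h1, ?_, h4⟩), Or.inl ⟨?_, ?_, ?_⟩⟩
      · linear_combination h1 + (d ^ 2 - a ^ 2) * h3
      · linear_combination b * (h4 + h3)
      · linear_combination c * (h4 + h3)
      · linear_combination (((a * a + b * c) * a + (a * b + b * d) * c) +
          ((c * a + d * c) * b + (c * b + d * d) * d)) * (a - d) * (h3 + h4)
  · rintro ⟨⟨rfl, rfl, h1⟩ | ⟨rfl, rfl, h1⟩ | ⟨hc, h1, h3, h4⟩, h5⟩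
    · have hd : d ≠ 0 := by rintro rfl; simp at h
      rcases h5 with ⟨-, -, h5⟩ | ⟨-, h5, -⟩
      · refine Or.inl ⟨rfl, rfl, ?_⟩
        apply mul_left_cancel₀ (pow_ne_zero 4 hd)
        linear_combination h5 - a ^ 2 * h1
      · exact absurd (by linear_combination h5 : d ^ 3 = 0) (pow_ne_zero 3 hd)
    · have hc : c ≠ 0 := by rintro rfl; simp at h
      have hb : b ≠ 0 := by rintro rfl; simp at h
      rcases h5 with ⟨h5, -, -⟩ | ⟨-, -, h5⟩
      · refine absurd (by linear_combination h5 : b * b * c = 0) ?_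
        simp [hb, hc]
      · refine Or.inr (Or.inl ⟨rfl, rfl, ?_⟩)
        apply mul_left_cancel₀ (mul_ne_zero (pow_ne_zero 2 hb) (pow_ne_zero 2 hc))
        linear_combination h5
    · right; right
      -- In terms of the trace and the determinant, the cube of the matrix `A` is
      -- `(a ^ 2 + d ^ 2) A - 2 a d (a + d)`.
      refine ⟨hc, h1, ?_, h4⟩
      rcases h5 with ⟨-, h5, -⟩ | ⟨h5, h6, -⟩
      · have h7 : c * (a ^ 2 + d ^ 2) = 0 := by linear_combination h5 - c * h4
        linear_combination (mul_eq_zero.1 h7).resolve_left hc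
      · have h7 : (a ^ 2 + d ^ 2) * (a - d) = 0 := by linear_combination h5 - h6 - (a - d) * h4
        rcases mul_eq_zero.1 h7 with h7 | h7
        · linear_combination h7
        · obtain rfl : a = d := sub_eq_zero.1 h7
          have ha : 2 * a ^ 3 = 0 := by linear_combination 3 * a * h4 - h5
          have ha : a = 0 := by simpa [h2] using ha
          refine absurd ?_ (pow_ne_zero 4 hc)
          rw [← h1, ha]; ring

lemma normalizer_tetrahedral (h2 : (2 : K) ≠ 0) {i : K} (hi : IsPrimitiveRoot i 4) :
    (Subgroup.normalizer (tetrahedral i) : Set PGL(2, K)) = octahedral i := by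
  rw [← normalizer_kleinFour h2 hi]
  apply Set.Subset.antisymm
  · intro g hg s
    rw [mem_kleinFour_iff_tetrahedral h2 hi, mem_kleinFour_iff_tetrahedral h2 hi, ← hg s,
      conj_pow, conj_eq_one_iff]
  · intro g hg s
    rw [mem_tetrahedral_iff_octahedral h2 hi, mem_tetrahedral_iff_octahedral h2 hi, conj_pow,
      ← hg (s ^ 3), ← normalizer_kleinFour h2 hi]
    refine and_congr_left fun _ ↦ ?_
    exact ((Subgroup.mul_mem_cancel_right _ (inv_mem hg)).trans
      (Subgroup.mul_mem_cancel_left _ hg)).symm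

/-- The nontrivial elements of `G_{V_4}` are the involutions that are squares in `G_{S_4}`, so that
`G_{V_4}` is characteristic in `G_{S_4}`. -/
lemma mem_kleinFour_iff_square (h2 : (2 : K) ≠ 0) {i : K} (hi : IsPrimitiveRoot i 4)
    (g : PGL(2, K)) :
    g ∈ kleinFour K ↔ g ^ 2 = 1 ∧ ∃ s ∈ octahedral i, s ^ 2 = g := by
  have hi2 := primitiveRoot_four_sq hi
  constructor
  · intro hg
    refine ⟨((mem_kleinFour_iff_tetrahedral h2 hi g).1 hg).2, ?_⟩
    obtain ⟨a, b, c, d, h, rfl⟩ := exists_eq_ofEntries g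
    rw [mem_kleinFour h] at hg
    rcases hg with ⟨rfl, rfl, h1⟩ | ⟨rfl, rfl, h1⟩
    · have hd : d ≠ 0 := by rintro rfl; simp at h
      rcases sq_eq_sq_iff_eq_or_eq_neg.1 h1 with rfl | rfl
      · have h' : (1 : K) * 1 - 0 * 0 ≠ 0 := by simp
        refine ⟨ofEntries 1 0 0 1, (mem_octahedral hi h').2 (by simp), ?_⟩
        rw [ofEntries_sq h']
        exact ofEntries_eq_of_smul a hd (sq_det_ne_zero h') (by ring) (by ring) (by ring) (by ring)
      · have h' : i * 1 - 0 * 0 ≠ 0 := by simpa using hi.ne_zero four_ne_zero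
        refine ⟨ofEntries i 0 0 1, (mem_octahedral hi h').2 (by simp [hi.pow_eq_one]), ?_⟩
        rw [ofEntries_sq h']
        exact ofEntries_eq_of_smul d hd (sq_det_ne_zero h') (by linear_combination d * hi2)
          (by ring) (by ring) (by ring)
    · have hc : c ≠ 0 := by rintro rfl; simp at h
      rcases sq_eq_sq_iff_eq_or_eq_neg.1 h1 with rfl | rfl
      · have h' : i * i - 1 * 1 ≠ 0 := fun h0 ↦ h2 (by linear_combination hi2 - h0)
        refine ⟨ofEntries i 1 1 i, (mem_octahedral hi h').2 (Or.inr (Or.inr ?_)), ?_⟩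
        · simp [hi.pow_eq_one, ← sq, hi2]
        · rw [ofEntries_sq h']
          exact ofEntries_eq_of_smul (-(b * i) / 2)
            (div_ne_zero (neg_ne_zero.2 (mul_ne_zero hc (hi.ne_zero four_ne_zero))) h2)
            (sq_det_ne_zero h') (by linear_combination -(b * i) / 2 * hi2)
            (by field_simp; linear_combination -2 * hi2)
            (by field_simp; linear_combination -2 * hi2)
            (by linear_combination -(b * i) / 2 * hi2)
      · have h' : (1 : K) * 1 - (-1) * 1 ≠ 0 := fun h0 ↦ h2 (by linear_combination h0)
        refine ⟨ofEntries 1 (-1) 1 1, (mem_octahedral hi h').2 (by simp), ?_⟩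
        rw [ofEntries_sq h']
        exact ofEntries_eq_of_smul (c / 2) (div_ne_zero hc h2) (sq_det_ne_zero h')
          (by ring) (by field_simp; ring) (by field_simp; ring) (by ring)
  · rintro ⟨hg, s, hs, rfl⟩
    obtain ⟨a, b, c, d, h, rfl⟩ := exists_eq_ofEntries s
    rw [ofEntries_sq h] at hg ⊢
    rw [ofEntries_sq_eq_one_iff (sq_det_ne_zero h)] at hg
    rw [mem_octahedral hi h] at hs
    rw [mem_kleinFour (sq_det_ne_zero h)]
    rcases hs with ⟨rfl, rfl, h1⟩ | ⟨rfl, rfl, h1⟩ | ⟨hc, h1, h3, h4⟩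
    · exact Or.inl ⟨by ring, by ring, by linear_combination h1⟩
    · exact Or.inl ⟨by ring, by ring, by ring⟩
    · rcases hg with hg | ⟨hb, hc, hd⟩
      · have had : a = d := by
          apply sub_eq_zero.1
          apply pow_eq_zero_iff two_ne_zero |>.1
          linear_combination hg - 2 * h4
        subst had
        refine Or.inr ⟨by linear_combination h4, by linear_combination h4, ?_⟩
        apply mul_left_cancel₀ (pow_ne_zero 2 hc)
        linear_combination 4 * a ^ 2 * ((b * c - a * a) * h4 + h1)
      · exact Or.inl ⟨hb, hc, by rw [hd]⟩

lemma normalizer_octahedral (h2 : (2 : K) ≠ 0) {i : K} (hi : IsPrimitiveRoot i 4) :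
    (Subgroup.normalizer (octahedral i) : Set PGL(2, K)) = octahedral i := by
  apply Set.Subset.antisymm
  · conv_rhs => rw [← normalizer_kleinFour h2 hi]
    have key (g : PGL(2, K)) (hg : g ∈ Subgroup.normalizer (octahedral i)) (v : PGL(2, K))
        (hv : v ∈ kleinFour K) : g * v * g⁻¹ ∈ kleinFour K := by
      rw [mem_kleinFour_iff_square h2 hi] at hv ⊢
      obtain ⟨hv, s, hs, rfl⟩ := hv
      refine ⟨by rw [conj_pow, conj_eq_one_iff, hv], g * s * g⁻¹, (hg s).1 hs, conj_pow⟩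
    exact subset_normalizer (fun g ↦ inv_mem) key
  · rw [← normalizer_kleinFour h2 hi]
    exact Subgroup.le_normalizer

/-! ### The icosahedral group and its normalizer -/

/-- The class of `diag(u, 1)`. -/
noncomputable def diagClass (u : Kˣ) : PGL(2, K) := ofEntries u 0 0 1

/-- The class of the matrix with rows `(0, 1)` and `(-1, 0)`. -/
noncomputable def weylClass (K : Type*) [Field K] : PGL(2, K) := ofEntries 0 1 (-1) 0

/-- The class of the traceless matrix with rows `(w, 1)` and `(1, -w)`. For `w ^ 2 + w = 1` it is
an involution of `G_{A_5}` that moves the pair of points `{0, ∞}`. -/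
noncomputable def goldenClass (w : K) : PGL(2, K) := ofEntries w 1 1 (-w)

lemma diag_det_ne_zero (u : Kˣ) : (u : K) * 1 - 0 * 0 ≠ 0 := by simp

lemma weyl_det_ne_zero : (0 : K) * 0 - 1 * -1 ≠ 0 := by simp

lemma golden_det_ne_zero (h5 : (5 : K) ≠ 0) {w : K} (hw : w ^ 2 + w = 1) :
    w * -w - 1 * 1 ≠ 0 :=
  -- If `w ^ 2 = -1` then `w = 2`, and `w ^ 2 + w = 1` reads `5 = 0`.
  fun h ↦ h5 (by linear_combination -h - (w + 2) * (h + hw))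

lemma golden_ne_zero {w : K} (hw : w ^ 2 + w = 1) : w ≠ 0 := by
  rintro rfl
  simp at hw

lemma golden_conj {w : K} (hw : w ^ 2 + w = 1) : (-1 - w) ^ 2 + (-1 - w) = 1 := by
  linear_combination hw

lemma golden_eq_or_eq {v w : K} (hv : v ^ 2 + v = 1) (hw : w ^ 2 + w = 1) :
    v = w ∨ v = -1 - w := by
  have h : (v - w) * (v - (-1 - w)) = 0 := by linear_combination hv - hw
  exact (mul_eq_zero.1 h).imp sub_eq_zero.1 sub_eq_zero.1

lemma diagClass_mul (u v : Kˣ) : diagClass u * diagClass v = diagClass (u * v) := by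
  rw [diagClass, diagClass, ofEntries_mul (diag_det_ne_zero u) (diag_det_ne_zero v), diagClass]
  congr 1 <;> simp

lemma diagClass_one : diagClass (1 : Kˣ) = 1 := by
  rw [diagClass, Units.val_one, ofEntries_one]

lemma diagClass_inv (u : Kˣ) : (diagClass u)⁻¹ = diagClass u⁻¹ := by
  rw [inv_eq_iff_mul_eq_one, diagClass_mul, mul_inv_cancel, diagClass_one]

lemma diagClass_pow (u : Kˣ) (n : ℕ) : diagClass u ^ n = diagClass (u ^ n) := by
  induction n with
  | zero => rw [pow_zero, pow_zero, diagClass_one]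
  | succ n ih => rw [pow_succ, ih, diagClass_mul, pow_succ]

lemma diagClass_eq_one_iff (u : Kˣ) : diagClass u = 1 ↔ u = 1 := by
  refine ⟨fun h ↦ ?_, fun h ↦ by rw [h, diagClass_one]⟩
  rw [diagClass, ← ofEntries_one, ofEntries_eq_iff (diag_det_ne_zero u) (by simp)] at h
  obtain ⟨k, -, h1, -, -, h4⟩ := h
  rw [mul_one] at h4
  rw [h4, one_mul] at h1
  exact Units.ext h1

lemma weylClass_mul_self : weylClass K * weylClass K = 1 := by
  rw [weylClass, ofEntries_mul weyl_det_ne_zero weyl_det_ne_zero, ← ofEntries_one]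
  symm
  refine ofEntries_eq_of_smul (-1) (by simp) (by simp) ?_ ?_ ?_ ?_ <;> ring

lemma weylClass_mul_diagClass (u : Kˣ) :
    weylClass K * diagClass u = diagClass u⁻¹ * weylClass K := by
  rw [weylClass, diagClass, diagClass, ofEntries_mul weyl_det_ne_zero (diag_det_ne_zero u),
    ofEntries_mul (diag_det_ne_zero _) weyl_det_ne_zero]
  refine ofEntries_eq_of_smul ((u⁻¹ : Kˣ) : K) (Units.ne_zero _) (by simp) ?_ ?_ ?_ ?_ <;> simp

lemma diagClass_mul_weylClass (u : Kˣ) :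
    diagClass u * weylClass K = ofEntries 0 (u : K) (-1) 0 := by
  rw [weylClass, diagClass, ofEntries_mul (diag_det_ne_zero u) weyl_det_ne_zero]
  congr 1 <;> simp

lemma goldenClass_mul_self (h5 : (5 : K) ≠ 0) {w : K} (hw : w ^ 2 + w = 1) :
    goldenClass w * goldenClass w = 1 := by
  have h := golden_det_ne_zero h5 hw
  have h' : w ^ 2 + 1 ≠ 0 := fun h0 ↦ h (by linear_combination -h0)
  rw [goldenClass, ofEntries_mul h h, ← ofEntries_one]
  symm
  refine ofEntries_eq_of_smul (w ^ 2 + 1) h' (by simp) ?_ ?_ ?_ ?_ <;> ring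

lemma weylClass_mul_goldenClass (h5 : (5 : K) ≠ 0) {w : K} (hw : w ^ 2 + w = 1) :
    weylClass K * goldenClass w = goldenClass (-1 - w) := by
  have h := golden_det_ne_zero h5 hw
  rw [goldenClass, weylClass, ofEntries_mul weyl_det_ne_zero h, goldenClass]
  refine ofEntries_eq_of_smul (-1 - w) (golden_ne_zero (golden_conj hw)) ?_ ?_ ?_ ?_ ?_
  · convert h using 1; ring
  · ring
  · linear_combination hw
  · linear_combination hw
  · ring

lemma goldenClass_mul_weylClass (h5 : (5 : K) ≠ 0) {w : K} (hw : w ^ 2 + w = 1) :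
    goldenClass w * weylClass K = goldenClass (-1 - w) := by
  have h := golden_det_ne_zero h5 hw
  rw [goldenClass, weylClass, ofEntries_mul h weyl_det_ne_zero, goldenClass]
  refine ofEntries_eq_of_smul (-(-1 - w)) (neg_ne_zero.2 (golden_ne_zero (golden_conj hw)))
    ?_ ?_ ?_ ?_ ?_
  · convert h using 1; ring
  · ring
  · linear_combination hw
  · linear_combination hw
  · ring

lemma diagClass_mul_goldenClass_mul_diagClass (h5 : (5 : K) ≠ 0) {w : K} (hw : w ^ 2 + w = 1)
    (u v : Kˣ) :
    diagClass u * goldenClass w * diagClass v = ofEntries (u * w * v : K) u v (-w) := by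
  have h := golden_det_ne_zero h5 hw
  have h' : (u : K) * w * -w - u * 1 ≠ 0 := by
    convert mul_ne_zero u.ne_zero h using 1; ring
  rw [goldenClass, diagClass, diagClass, ofEntries_mul (diag_det_ne_zero u) h,
    ofEntries_mul (by convert h' using 1; ring) (diag_det_ne_zero v)]
  congr 1 <;> ring

lemma diag_golden_diag_det_ne_zero (h5 : (5 : K) ≠ 0) {w : K} (hw : w ^ 2 + w = 1)
    (u v : Kˣ) : (u * w * v : K) * -w - u * v ≠ 0 := by
  convert mul_ne_zero (mul_ne_zero u.ne_zero v.ne_zero) (golden_det_ne_zero h5 hw) using 1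
  ring

lemma goldenClass_mul_diagClass_mul_goldenClass (h5 : (5 : K) ≠ 0) {w : K} (hw : w ^ 2 + w = 1)
    (e : Kˣ) :
    goldenClass w * diagClass e * goldenClass w =
      ofEntries (w ^ 2 * e + 1 : K) (w * e - w) (w * e - w) (e + w ^ 2) := by
  have h := golden_det_ne_zero h5 hw
  have h' : w * e * -w - 1 * e ≠ 0 := by
    convert mul_ne_zero e.ne_zero h using 1; ring
  rw [goldenClass, diagClass, ofEntries_mul h (diag_det_ne_zero e),
    ofEntries_mul (by convert h' using 1; ring) h]
  congr 1 <;> ring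

/-- The relation of `G_{A_5}` behind its elements of order five outside the dihedral group. -/
lemma golden_relation (h5 : (5 : K) ≠ 0) {w : K} (hw : w ^ 2 + w = 1)
    {e : Kˣ} (he : (e : K) + (e⁻¹ : Kˣ) = w) :
    goldenClass w * diagClass e * goldenClass w =
      diagClass e * goldenClass (-1 - w) * diagClass e := by
  have hw' := golden_conj hw
  rw [goldenClass_mul_diagClass_mul_goldenClass h5 hw,
    diagClass_mul_goldenClass_mul_diagClass h5 hw']
  have hef : (e : K) * (e⁻¹ : Kˣ) = 1 := e.mul_inv
  symm
  generalize ((e⁻¹ : Kˣ) : K) = f at he hef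
  have hd' := diag_golden_diag_det_ne_zero h5 hw' e e
  generalize (e : K) = e at *
  refine ofEntries_eq_of_smul (w * (1 - f)) ?_ hd' ?_ ?_ ?_ ?_
  · refine mul_ne_zero (golden_ne_zero hw) fun h0 ↦ h5 ?_
    obtain rfl : f = 1 := by linear_combination -h0
    obtain rfl : e = 1 := by linear_combination hef
    rw [← he] at hw
    linear_combination hw
  · linear_combination -(e ^ 2 - f * e ^ 2) * hw + e * hef - e * hw - e * he + hef
  · linear_combination -w * hef
  · linear_combination -w * hef
  · linear_combination (1 - f) * hw - hw - he

/-- The relation of `G_{A_5}` behind its elements of order three. -/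
lemma golden_relation' (h5 : (5 : K) ≠ 0) {w : K} (hw : w ^ 2 + w = 1)
    {e : Kˣ} (he : (e : K) + (e⁻¹ : Kˣ) = -1 - w) :
    goldenClass w * diagClass e * goldenClass w =
      diagClass e⁻¹ * goldenClass w * diagClass e⁻¹ := by
  rw [goldenClass_mul_diagClass_mul_goldenClass h5 hw,
    diagClass_mul_goldenClass_mul_diagClass h5 hw]
  have hef : (e : K) * (e⁻¹ : Kˣ) = 1 := e.mul_inv
  symm
  have hd' := diag_golden_diag_det_ne_zero h5 hw e⁻¹ e⁻¹
  generalize ((e⁻¹ : Kˣ) : K) = f at *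
  generalize (e : K) = e at *
  refine ofEntries_eq_of_smul (w * (e ^ 2 - e)) ?_ hd' ?_ ?_ ?_ ?_
  · have h0 : w * (e * (e - 1)) ≠ 0 := by
      refine mul_ne_zero (golden_ne_zero hw) (mul_ne_zero (left_ne_zero_of_mul_eq_one hef) ?_)
      intro h0
      obtain rfl : e = 1 := by linear_combination h0
      obtain rfl : f = 1 := by linear_combination hef
      obtain rfl : w = -3 := by linear_combination he
      exact h5 (by linear_combination hw)
    convert h0 using 1; ring
  · linear_combination w ^ 2 * (e * f + 1 - f) * hef - w ^ 2 * he + (w + 1) * hw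
  · linear_combination w * (e - 1) * hef
  · linear_combination w * (e - 1) * hef
  · linear_combination w ^ 2 * (hef - e * he) + e * (w + 1) * hw

/-- Membership in `G_{A_5}`: `g` lies in the dihedral group generated by the Weyl element and the
`diag(u, 1)` with `u ^ 5 = 1`, or in the double coset of this group through an involution
`goldenClass w`. (Both roots `w` are allowed, which makes a Weyl factor superfluous in the last
case.) The description does not involve the choices of `ε` and `√5`. -/
def IsIcosahedral (g : PGL(2, K)) : Prop :=
  (∃ u : Kˣ, u ^ 5 = 1 ∧ g = diagClass u) ∨
  (∃ u : Kˣ, u ^ 5 = 1 ∧ g = diagClass u * weylClass K) ∨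
  ∃ (u v : Kˣ) (w : K), u ^ 5 = 1 ∧ v ^ 5 = 1 ∧ w ^ 2 + w = 1 ∧
    g = diagClass u * goldenClass w * diagClass v

lemma isIcosahedral_goldenClass {w : K} (hw : w ^ 2 + w = 1) : IsIcosahedral (goldenClass w) :=
  Or.inr (Or.inr ⟨1, 1, w, one_pow 5, one_pow 5, hw, by rw [diagClass_one, one_mul, mul_one]⟩)

lemma isIcosahedral_weylClass : IsIcosahedral (weylClass K) :=
  Or.inr (Or.inl ⟨1, one_pow 5, by rw [diagClass_one, one_mul]⟩)

lemma isIcosahedral_diagClass {u : Kˣ} (hu : u ^ 5 = 1) : IsIcosahedral (diagClass u) :=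
  Or.inl ⟨u, hu, rfl⟩

lemma IsIcosahedral.diagClass_mul {g : PGL(2, K)} (hg : IsIcosahedral g) {u : Kˣ}
    (hu : u ^ 5 = 1) : IsIcosahedral (diagClass u * g) := by
  rcases hg with ⟨x, hx, rfl⟩ | ⟨x, hx, rfl⟩ | ⟨x, y, w, hx, hy, hw, rfl⟩
  · exact Or.inl ⟨u * x, by rw [mul_pow, hu, hx, one_mul], PGLTwo.diagClass_mul u x⟩
  · exact Or.inr (Or.inl ⟨u * x, by rw [mul_pow, hu, hx, one_mul],
      by rw [← mul_assoc, PGLTwo.diagClass_mul u x]⟩)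
  · exact Or.inr (Or.inr ⟨u * x, y, w, by rw [mul_pow, hu, hx, one_mul], hy, hw,
      by rw [← mul_assoc, ← mul_assoc, PGLTwo.diagClass_mul u x]⟩)

lemma IsIcosahedral.weylClass_mul (h5 : (5 : K) ≠ 0) {g : PGL(2, K)} (hg : IsIcosahedral g) :
    IsIcosahedral (weylClass K * g) := by
  rcases hg with ⟨x, hx, rfl⟩ | ⟨x, hx, rfl⟩ | ⟨x, y, w, hx, hy, hw, rfl⟩
  · exact Or.inr (Or.inl ⟨x⁻¹, by rw [inv_pow, hx, inv_one], weylClass_mul_diagClass x⟩)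
  · refine Or.inl ⟨x⁻¹, by rw [inv_pow, hx, inv_one], ?_⟩
    rw [← mul_assoc, weylClass_mul_diagClass, mul_assoc, weylClass_mul_self, mul_one]
  · refine Or.inr (Or.inr ⟨x⁻¹, y, -1 - w, by rw [inv_pow, hx, inv_one], hy, golden_conj hw, ?_⟩)
    rw [← mul_assoc, ← mul_assoc, weylClass_mul_diagClass, mul_assoc (diagClass x⁻¹),
      weylClass_mul_goldenClass h5 hw]

/-- For a primitive fifth root of unity `e` the sum `e + e⁻¹` is a root of `X ^ 2 + X - 1`. -/
lemma golden_of_pow_five {e : Kˣ} (he : e ^ 5 = 1) (he1 : e ≠ 1) :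
    ((e : K) + (e⁻¹ : Kˣ)) ^ 2 + ((e : K) + (e⁻¹ : Kˣ)) = 1 := by
  have hef : (e : K) * (e⁻¹ : Kˣ) = 1 := e.mul_inv
  have he' : (e : K) ^ 5 = 1 := by rw [← Units.val_pow_eq_pow_val, he, Units.val_one]
  have h1 : (e : K) - 1 ≠ 0 := fun h ↦ he1 (Units.ext (by simpa using sub_eq_zero.1 h))
  generalize ((e⁻¹ : Kˣ) : K) = f at *
  have he0 := left_ne_zero_of_mul_eq_one hef
  have h : (e : K) ^ 4 + e ^ 3 + e ^ 2 + e + 1 = 0 :=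
    (mul_eq_zero.1 (by linear_combination he' :
      ((e : K) - 1) * (e ^ 4 + e ^ 3 + e ^ 2 + e + 1) = 0)).resolve_left h1
  apply mul_left_cancel₀ (pow_ne_zero 2 he0)
  linear_combination h + (e * f + 1 + e + 2 * e ^ 2) * hef

lemma IsIcosahedral.goldenClass_mul (h5 : (5 : K) ≠ 0) {w : K} (hw : w ^ 2 + w = 1)
    {g : PGL(2, K)} (hg : IsIcosahedral g) : IsIcosahedral (goldenClass w * g) := by
  have key (e y : Kˣ) (he : e ^ 5 = 1) (hy : y ^ 5 = 1) :
      IsIcosahedral (goldenClass w * diagClass e * goldenClass w * diagClass y) := by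
    by_cases he1 : e = 1
    · rw [he1, diagClass_one, mul_one, goldenClass_mul_self h5 hw, one_mul]
      exact isIcosahedral_diagClass hy
    · rcases golden_eq_or_eq (golden_of_pow_five he he1) hw with h | h
      · rw [golden_relation h5 hw h, mul_assoc, PGLTwo.diagClass_mul]
        exact Or.inr (Or.inr ⟨e, e * y, _, he, by rw [mul_pow, he, hy, one_mul], golden_conj hw,
          rfl⟩)
      · rw [golden_relation' h5 hw h, mul_assoc, PGLTwo.diagClass_mul]
        have he' : e⁻¹ ^ 5 = 1 := by rw [inv_pow, he, inv_one]
        exact Or.inr (Or.inr ⟨e⁻¹, e⁻¹ * y, w, he', by rw [mul_pow, he', hy, one_mul], hw, rfl⟩)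
  rcases hg with ⟨x, hx, rfl⟩ | ⟨x, hx, rfl⟩ | ⟨x, y, v, hx, hy, hv, rfl⟩
  · exact Or.inr (Or.inr ⟨1, x, w, one_pow 5, hx, hw, by rw [diagClass_one, one_mul]⟩)
  · refine Or.inr (Or.inr ⟨1, x⁻¹, -1 - w, one_pow 5, by rw [inv_pow, hx, inv_one],
      golden_conj hw, ?_⟩)
    rw [diagClass_one, one_mul, ← goldenClass_mul_weylClass h5 hw, mul_assoc,
      weylClass_mul_diagClass, inv_inv]
  · rcases golden_eq_or_eq hv hw with rfl | rfl
    · rw [← mul_assoc, ← mul_assoc]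
      exact key x y hx hy
    · have hx' : x⁻¹ ^ 5 = 1 := by rw [inv_pow, hx, inv_one]
      convert (key x⁻¹ y hx' hy).weylClass_mul h5 using 1
      rw [← weylClass_mul_goldenClass h5 hw]
      simp only [← mul_assoc]
      rw [mul_assoc (goldenClass w) (diagClass x), ← inv_inv x, ← weylClass_mul_diagClass,
        ← mul_assoc, goldenClass_mul_weylClass h5 hw, weylClass_mul_goldenClass h5 hw, inv_inv]

lemma IsIcosahedral.mul (h5 : (5 : K) ≠ 0) {g h : PGL(2, K)} (hg : IsIcosahedral g)
    (hh : IsIcosahedral h) : IsIcosahedral (g * h) := by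
  rcases hg with ⟨x, hx, rfl⟩ | ⟨x, hx, rfl⟩ | ⟨x, y, w, hx, hy, hw, rfl⟩
  · exact hh.diagClass_mul hx
  · rw [mul_assoc]
    exact (hh.weylClass_mul h5).diagClass_mul hx
  · rw [mul_assoc, mul_assoc]
    exact ((hh.diagClass_mul hy).goldenClass_mul h5 hw).diagClass_mul hx

lemma goldenClass_inv (h5 : (5 : K) ≠ 0) {w : K} (hw : w ^ 2 + w = 1) :
    (goldenClass w)⁻¹ = goldenClass w :=
  inv_eq_of_mul_eq_one_left (goldenClass_mul_self h5 hw)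

lemma IsIcosahedral.inv (h5 : (5 : K) ≠ 0) {g : PGL(2, K)} (hg : IsIcosahedral g) :
    IsIcosahedral g⁻¹ := by
  have hi {u : Kˣ} (hu : u ^ 5 = 1) : u⁻¹ ^ 5 = 1 := by rw [inv_pow, hu, inv_one]
  rcases hg with ⟨x, hx, rfl⟩ | ⟨x, hx, rfl⟩ | ⟨x, y, w, hx, hy, hw, rfl⟩
  · rw [diagClass_inv]
    exact isIcosahedral_diagClass (hi hx)
  · rw [mul_inv_rev, diagClass_inv, inv_eq_of_mul_eq_one_left weylClass_mul_self]
    exact (isIcosahedral_diagClass (hi hx)).weylClass_mul h5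
  · rw [mul_inv_rev, mul_inv_rev, diagClass_inv, diagClass_inv, goldenClass_inv h5 hw,
      ← mul_assoc]
    exact Or.inr (Or.inr ⟨y⁻¹, x⁻¹, w, hi hy, hi hx, hw, rfl⟩)

/-- `G_{A_5}` as a subgroup. -/
def icosahedralSubgroup (h5 : (5 : K) ≠ 0) : Subgroup PGL(2, K) where
  carrier := {g | IsIcosahedral g}
  mul_mem' := IsIcosahedral.mul h5
  one_mem' := by
    rw [← diagClass_one]
    exact isIcosahedral_diagClass (one_pow 5)
  inv_mem' := IsIcosahedral.inv h5

lemma coe_icosahedralSubgroup (h2 : (2 : K) ≠ 0) (h5 : (5 : K) ≠ 0) {ε s : K}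
    (hε : IsPrimitiveRoot ε 5) (hs : s ^ 2 = 5) :
    (icosahedralSubgroup h5 : Set PGL(2, K)) = icosahedral ε s := by
  have hε0 : ε ≠ 0 := hε.ne_zero (by norm_num)
  have hroot (w : K) : (w = (-1 + s) / 2 ∨ w = (-1 - s) / 2) ↔ w ^ 2 + w = 1 := by
    rw [eq_div_iff h2, eq_div_iff h2, ← sub_eq_zero, ← sub_eq_zero (a := w * 2), ← mul_eq_zero]
    constructor
    · intro h
      apply mul_left_cancel₀ (pow_ne_zero 2 h2)
      linear_combination h + hs
    · intro h
      linear_combination 4 * h - hs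
  have hpow {u : Kˣ} (hu : u ^ 5 = 1) : ∃ r < 5, ε ^ r = u := by
    have hu' : (u : K) ^ 5 = 1 ^ 5 := by rw [← Units.val_pow_eq_pow_val, hu]; simp
    obtain ⟨r, hr, h⟩ := exists_pow_eq_of_pow_eq (by norm_num) hε one_ne_zero hu'
    exact ⟨r, hr, by rw [h, div_one]⟩
  have hunit (r : ℕ) : (Units.mk0 ε hε0 ^ r) ^ 5 = 1 := by
    apply Units.ext
    simpa using primitiveRoot_pow_pow hε r
  apply Set.Subset.antisymm
  · rintro _ (⟨u, hu, rfl⟩ | ⟨u, hu, rfl⟩ | ⟨u, v, w, hu, hv, hw, rfl⟩)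
    · obtain ⟨r, hr, h⟩ := hpow hu
      rw [diagClass, icosahedral, ofEntries_mem_classes (diag_det_ne_zero u)]
      exact ⟨1, one_ne_zero, r, 0, hr, by norm_num, Or.inl (by simp [h])⟩
    · obtain ⟨r, hr, h⟩ := hpow hu
      rw [diagClass_mul_weylClass, icosahedral, ofEntries_mem_classes (by simp)]
      exact ⟨1, one_ne_zero, r, 0, hr, by norm_num, Or.inr (Or.inl (by simp [h]))⟩
    · obtain ⟨r, hr, h⟩ := hpow hu
      obtain ⟨t, ht, h'⟩ := hpow hv
      rw [diagClass_mul_goldenClass_mul_diagClass h5 hw, icosahedral,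
        ofEntries_mem_classes (diag_golden_diag_det_ne_zero h5 hw u v)]
      refine ⟨(v : K)⁻¹, inv_ne_zero v.ne_zero, r, t, hr, ht,
        Or.inr (Or.inr ⟨w, (hroot w).2 hw, ?_⟩)⟩
      rw [zpow_sub₀ hε0, zpow_neg, zpow_natCast, zpow_natCast, h, h']
      have hv0 := v.ne_zero
      congr 3
      · field_simp
      · field_simp
      · field_simp
  · rintro _ ⟨M, ⟨r, t, hr, ht, hM | hM | ⟨w, hw, hM⟩⟩, rfl⟩ <;> rw [mk_eq_ofEntries, hM]
    · exact Or.inl ⟨Units.mk0 ε hε0 ^ r, hunit r, by simp [diagClass]⟩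
    · exact Or.inr (Or.inl ⟨Units.mk0 ε hε0 ^ r, hunit r, by simp [diagClass_mul_weylClass]⟩)
    · have hw' := (hroot w).1 hw
      refine Or.inr (Or.inr
        ⟨Units.mk0 ε hε0 ^ r, Units.mk0 ε hε0 ^ t, w, hunit r, hunit t, hw', ?_⟩)
      rw [diagClass_mul_goldenClass_mul_diagClass h5 hw']
      have ht0 : ε ^ t ≠ 0 := pow_ne_zero t hε0
      symm
      refine ofEntries_eq_of_smul (ε ^ t)⁻¹ (inv_ne_zero ht0)
        (diag_golden_diag_det_ne_zero h5 hw' _ _) ?_ ?_ ?_ ?_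
      · simp
        field_simp
      · simp [zpow_sub₀ hε0]
        field_simp
      · simp [hε0]
      · simp

/-- An element of order five of `G_{A_5}` is conjugate in `G_{A_5}` to a diagonal one: the
hypotheses exclude the involutions and the elements of order three. -/
lemma IsIcosahedral.exists_conj_eq_diagClass (h5 : (5 : K) ≠ 0) {g : PGL(2, K)}
    (hg : IsIcosahedral g) (hg2 : g ^ 2 ≠ 1) (hg3 : g ^ 3 ≠ 1) :
    ∃ s, IsIcosahedral s ∧ ∃ u, s * g * s⁻¹ = diagClass u := by
  rcases hg with ⟨x, hx, rfl⟩ | ⟨x, hx, rfl⟩ | ⟨x, y, w, hx, hy, hw, rfl⟩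
  · exact ⟨1, (icosahedralSubgroup h5).one_mem, x, by group⟩
  · refine absurd ?_ hg2
    rw [pow_two, mul_assoc, ← mul_assoc (weylClass K), weylClass_mul_diagClass, mul_assoc,
      weylClass_mul_self, mul_one, PGLTwo.diagClass_mul, mul_inv_cancel, diagClass_one]
  · -- Up to conjugation by a diagonal element, `g` is `diagClass e * goldenClass w`.
    set e := y * x with he
    have he5 : e ^ 5 = 1 := by rw [he, mul_pow, hx, hy, one_mul]
    have hge : diagClass x * goldenClass w * diagClass y =
        (diagClass y)⁻¹ * (diagClass e * goldenClass w) * diagClass y := by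
      rw [he, ← PGLTwo.diagClass_mul]; group
    have hge2 : (diagClass e * goldenClass w) ^ 2 ≠ 1 := by
      intro h
      apply hg2
      have := conj_pow (i := 2) (a := (diagClass y)⁻¹) (b := diagClass e * goldenClass w)
      rw [inv_inv] at this
      rw [hge, this, h]; group
    have hge3 : (diagClass e * goldenClass w) ^ 3 ≠ 1 := by
      intro h
      apply hg3
      have := conj_pow (i := 3) (a := (diagClass y)⁻¹) (b := diagClass e * goldenClass w)
      rw [inv_inv] at this
      rw [hge, this, h]; group
    have he1 : e ≠ 1 := by
      intro h
      rw [h, diagClass_one, one_mul, pow_two, goldenClass_mul_self h5 hw] at hge2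
      exact hge2 rfl
    rcases golden_eq_or_eq (golden_of_pow_five he5 he1) hw with h | h
    · -- Here `f = e ^ 3` satisfies `f ^ 2 = e` and `f + f⁻¹ = -1 - w`.
      have hf : ((e ^ 3 : Kˣ) : K) + ((e ^ 3 : Kˣ)⁻¹ : Kˣ) = -1 - w := by
        have hef : (e : K) * (e⁻¹ : Kˣ) = 1 := e.mul_inv
        have h3 : e ^ 3 = e⁻¹ ^ 2 := by
          rw [inv_pow, eq_inv_iff_mul_eq_one, ← pow_add, he5]
        rw [h3, inv_pow, inv_inv, ← inv_pow, Units.val_pow_eq_pow_val, Units.val_pow_eq_pow_val]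
        linear_combination ((e : K) + (e⁻¹ : Kˣ) + w) * h + hw - 2 * hef
      have hrel := golden_relation h5 (golden_conj hw) hf
      rw [show -1 - (-1 - w) = w by ring] at hrel
      have hff : diagClass (e ^ 3) * diagClass (e ^ 3) = diagClass e := by
        rw [PGLTwo.diagClass_mul, ← pow_add, show 3 + 3 = 5 + 1 from rfl, pow_succ, he5, one_mul]
      refine ⟨goldenClass (-1 - w) * (diagClass (e ^ 3))⁻¹ * diagClass y, ?_, e ^ 3, ?_⟩
      · rw [diagClass_inv, mul_assoc]
        refine IsIcosahedral.goldenClass_mul h5 (golden_conj hw)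
          (IsIcosahedral.diagClass_mul (isIcosahedral_diagClass hy) ?_)
        rw [inv_pow, ← pow_mul, mul_comm, pow_mul, he5, one_pow, inv_one]
      · rw [hge, ← hff]
        have hT := goldenClass_mul_self h5 (golden_conj hw)
        have hT' := goldenClass_inv h5 (golden_conj hw)
        calc _ = goldenClass (-1 - w) * (diagClass (e ^ 3) * goldenClass w * diagClass (e ^ 3)) *
              (goldenClass (-1 - w))⁻¹ := by group
          _ = (goldenClass (-1 - w) * goldenClass (-1 - w)) * diagClass (e ^ 3) *
              (goldenClass (-1 - w) * goldenClass (-1 - w)) := by rw [← hrel, hT']; group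
          _ = _ := by rw [hT]; group
    · refine absurd ?_ hge3
      have hrel := golden_relation' h5 hw h
      calc _ = diagClass e * (goldenClass w * diagClass e * goldenClass w) * diagClass e *
            goldenClass w := by simp only [pow_succ, pow_zero, one_mul, mul_assoc]
        _ = goldenClass w * goldenClass w := by rw [hrel, ← diagClass_inv]; group
        _ = 1 := goldenClass_mul_self h5 hw

/-- A diagonal element that normalizes `G_{A_5}` belongs to it: it must conjugate
`goldenClass w` into `G_{A_5}`. -/
lemma pow_five_of_conj_goldenClass (h2 : (2 : K) ≠ 0) (h5 : (5 : K) ≠ 0) {w : K}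
    (hw : w ^ 2 + w = 1) {α : Kˣ}
    (h : IsIcosahedral (diagClass α * goldenClass w * (diagClass α)⁻¹)) : α ^ 5 = 1 := by
  rw [diagClass_inv, diagClass_mul_goldenClass_mul_diagClass h5 hw] at h
  have hd := diag_golden_diag_det_ne_zero h5 hw α α⁻¹
  have hw0 := golden_ne_zero hw
  rcases h with ⟨x, hx, h⟩ | ⟨x, hx, h⟩ | ⟨x, y, v, hx, hy, hv, h⟩
  · rw [diagClass, ofEntries_eq_iff hd (diag_det_ne_zero x)] at h
    obtain ⟨k, hk, -, h, -⟩ := h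
    exact absurd h (mul_ne_zero hk α.ne_zero)
  · rw [diagClass_mul_weylClass, ofEntries_eq_iff hd (by simp)] at h
    obtain ⟨k, hk, -, -, -, h⟩ := h
    exact absurd h (mul_ne_zero hk (neg_ne_zero.2 hw0))
  · rw [diagClass_mul_goldenClass_mul_diagClass h5 hv,
      ofEntries_eq_iff hd (diag_golden_diag_det_ne_zero h5 hv x y)] at h
    obtain ⟨k, hk, hk1, hk2, hk3, hk4⟩ := h
    have hαβ : (α : K) * (α⁻¹ : Kˣ) = 1 := α.mul_inv
    have hv0 := golden_ne_zero hv
    have hxy : (x : K) * y = 1 := by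
      apply mul_left_cancel₀ hv0
      linear_combination k * w * hαβ - hk1 - hk4
    have hk' : k ^ 2 = 1 := by
      linear_combination hxy + k * (α⁻¹ : Kˣ) * hk2 + x * hk3 - k ^ 2 * hαβ
    rcases sq_eq_sq_iff_eq_or_eq_neg.1 (hk'.trans (one_pow 2).symm) with rfl | rfl
    · have : α = x := Units.ext (by linear_combination hk2)
      rw [this, hx]
    · have hvw : v = -w := by linear_combination hk4
      refine absurd ?_ (mul_ne_zero h2 hw0)
      rw [hvw] at hv
      linear_combination hw - hv

lemma normalizer_icosahedral (h2 : (2 : K) ≠ 0) {ε s : K} (hε : IsPrimitiveRoot ε 5)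
    (hs : s ^ 2 = 5) :
    (Subgroup.normalizer (icosahedral ε s) : Set PGL(2, K)) = icosahedral ε s := by
  have h5 : (5 : K) ≠ 0 := by exact_mod_cast hε.neZero'.out
  rw [← coe_icosahedralSubgroup h2 h5 hε hs]
  refine Set.Subset.antisymm ?_ Subgroup.le_normalizer
  have hw : ((-1 + s) / 2) ^ 2 + (-1 + s) / 2 = 1 := by
    field_simp
    linear_combination hs
  -- A normalizing diagonal element is in the group, hence so is every normalizing element that
  -- fixes or exchanges the points `0` and `∞`.
  have hdiag (α : Kˣ) (h : diagClass α ∈ Subgroup.normalizer (icosahedralSubgroup h5 : Set _)) :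
      diagClass α ∈ icosahedralSubgroup h5 :=
    isIcosahedral_diagClass
      (pow_five_of_conj_goldenClass h2 h5 hw ((h _).1 (isIcosahedral_goldenClass hw)))
  have hdiag' (a d : K) (h : a * d ≠ 0)
      (hn : ofEntries a 0 0 d ∈ Subgroup.normalizer (icosahedralSubgroup h5 : Set _)) :
      ofEntries a 0 0 d ∈ icosahedralSubgroup h5 := by
    have hd := right_ne_zero_of_mul h
    have he : ofEntries a 0 0 d = diagClass (Units.mk0 (a / d)
        (div_ne_zero (left_ne_zero_of_mul h) hd)) :=
      ofEntries_eq_of_smul d⁻¹ (inv_ne_zero hd) (by simpa using h)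
        (by rw [Units.val_mk0, div_eq_inv_mul]) (by simp) (by simp) (inv_mul_cancel₀ hd)
    rw [he] at hn ⊢
    exact hdiag _ hn
  intro g hg
  have hε0 : ε ≠ 0 := hε.ne_zero (by norm_num)
  set e := Units.mk0 ε hε0 with he
  have hpe (n : ℕ) (hn : 0 < n) (hn5 : n < 5) : (g * diagClass e * g⁻¹) ^ n ≠ 1 := by
    rw [conj_pow, Ne, conj_eq_one_iff, diagClass_pow, diagClass_eq_one_iff]
    intro h
    refine hε.pow_ne_one_of_pos_of_lt hn.ne' hn5 ?_
    simpa [he] using congrArg (Units.val) h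
  have he5 : e ^ 5 = 1 := Units.ext (by simpa [he] using hε.pow_eq_one)
  obtain ⟨t, ht, u, htu⟩ := IsIcosahedral.exists_conj_eq_diagClass h5
    ((hg _).1 (isIcosahedral_diagClass he5)) (hpe 2 two_pos (by norm_num))
    (hpe 3 three_pos (by norm_num))
  replace ht : t ∈ icosahedralSubgroup h5 := ht
  have htn := Subgroup.le_normalizer (H := icosahedralSubgroup h5) ht
  suffices htg : t * g ∈ icosahedralSubgroup h5 from (Subgroup.mul_mem_cancel_left _ ht).1 htg
  have hn := mul_mem htn hg
  have hconj : t * g * diagClass e * (t * g)⁻¹ = diagClass u := by rw [← htu]; group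
  generalize t * g = m at hn hconj
  obtain ⟨a, b, c, d, h, rfl⟩ := exists_eq_ofEntries m
  rw [diagClass, diagClass, ofEntries_conj h (diag_det_ne_zero e),
    ofEntries_eq_iff (conj_det_ne_zero h (diag_det_ne_zero e)) (diag_det_ne_zero u)] at hconj
  obtain ⟨k, hk, -, h12, h21, -⟩ := hconj
  have hmon := monomial_of_conj_diagonal h (hε.ne_one (by norm_num))
    ((mul_eq_zero.1 h12).resolve_left hk) ((mul_eq_zero.1 h21).resolve_left hk)
  rcases hmon with ⟨rfl, rfl⟩ | ⟨rfl, rfl⟩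
  · exact hdiag' a d (by simpa using h) hn
  · have hW : weylClass K ∈ icosahedralSubgroup h5 := isIcosahedral_weylClass
    have hWm : weylClass K * ofEntries 0 b c 0 = ofEntries c 0 0 (-b) := by
      rw [weylClass, ofEntries_mul weyl_det_ne_zero h]
      congr 1 <;> ring
    have hn' := mul_mem (Subgroup.le_normalizer hW) hn
    rw [← Subgroup.mul_mem_cancel_left _ hW]
    rw [hWm] at hn' ⊢
    exact hdiag' c (-b) (by intro h0; apply h; linear_combination h0) hn'

/-! ### Normalizers of the groups of Lie type -/

section

variable {F : Type*} [Field F] (φ : F →+* K)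

lemma pslOver_le_pglOver : pslOver φ ≤ pglOver φ := by
  rintro _ ⟨x, rfl⟩
  exact ⟨_, rfl⟩

lemma map_ofEntries {a b c d : F} (h : a * d - b * c ≠ 0) :
    Matrix.ProjGenLinGroup.map (n := Fin 2) φ (ofEntries a b c d) =
      ofEntries (φ a) (φ b) (φ c) (φ d) := by
  rw [ofEntries_of_ne h, Matrix.ProjGenLinGroup.map_mk, mk_eq_ofEntries]
  rfl

lemma map_det_ne_zero {a b c d : F} (h : a * d - b * c ≠ 0) :
    φ a * φ d - φ b * φ c ≠ 0 := by
  rw [← map_mul, ← map_mul, ← map_sub]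
  exact (map_ne_zero φ).2 h

lemma mem_pglOver {a b c d : K} (h : a * d - b * c ≠ 0) :
    ofEntries a b c d ∈ pglOver φ ↔
      ∃ k ≠ 0, k * a ∈ φ.fieldRange ∧ k * b ∈ φ.fieldRange ∧ k * c ∈ φ.fieldRange ∧
        k * d ∈ φ.fieldRange := by
  constructor
  · rintro ⟨g, hg⟩
    obtain ⟨a', b', c', d', h', rfl⟩ := exists_eq_ofEntries g
    rw [map_ofEntries φ h', eq_comm,
      ofEntries_eq_iff h (map_det_ne_zero φ h')] at hg
    obtain ⟨k, hk, ha, hb, hc, hd⟩ := hg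
    exact ⟨k, hk, ⟨a', ha.symm⟩, ⟨b', hb.symm⟩, ⟨c', hc.symm⟩, ⟨d', hd.symm⟩⟩
  · rintro ⟨k, hk, ⟨a', ha⟩, ⟨b', hb⟩, ⟨c', hc⟩, ⟨d', hd⟩⟩
    have h' : a' * d' - b' * c' ≠ 0 := by
      rw [← map_ne_zero φ, map_sub, map_mul, map_mul, ha, hb, hc, hd]
      convert mul_ne_zero (mul_ne_zero hk hk) h using 1; ring
    refine ⟨ofEntries a' b' c' d', ?_⟩
    rw [map_ofEntries φ h']
    exact (ofEntries_eq_of_smul k hk h ha.symm hb.symm hc.symm hd.symm).symm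

lemma map_mk_mem_pslOver {M : GL (Fin 2) F} (h : (M : Matrix (Fin 2) (Fin 2) F).det = 1) :
    Matrix.ProjGenLinGroup.map (n := Fin 2) φ (Matrix.ProjGenLinGroup.mk M) ∈ pslOver φ := by
  let s : Matrix.SpecialLinearGroup (Fin 2) F := ⟨M, h⟩
  have hs : Matrix.SpecialLinearGroup.toGL s = M := Units.ext rfl
  rw [← hs]
  exact ⟨QuotientGroup.mk s, rfl⟩

lemma ofEntries_mem_pslOver {a b c d : F} (h : a * d - b * c = 1) :
    ofEntries (φ a) (φ b) (φ c) (φ d) ∈ pslOver φ := by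
  have h' : a * d - b * c ≠ 0 := by rw [h]; exact one_ne_zero
  rw [← map_ofEntries φ h', ofEntries_of_ne h']
  exact map_mk_mem_pslOver φ ((Matrix.det_fin_two_of a b c d).trans h)

/-- `PSL(2, F)` is normal in `PGL(2, F)` because conjugation preserves the determinant. -/
lemma pglOver_le_normalizer_pslOver :
    pglOver φ ≤ Subgroup.normalizer (pslOver φ : Set PGL(2, K)) := by
  rw [Subgroup.le_normalizer_iff]
  rintro _ ⟨g, rfl⟩ _ ⟨s, rfl⟩
  induction g using Matrix.ProjGenLinGroup.induction_on with | mk g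
  induction s using QuotientGroup.induction_on with | H s
  rw [MonoidHom.comp_apply, Matrix.ProjectiveSpecialLinearGroup.toPGL_mk, ← map_inv, ← map_mul,
    ← map_mul, ← map_inv, ← map_mul, ← map_mul]
  refine map_mk_mem_pslOver φ ?_
  rw [← Matrix.GeneralLinearGroup.val_det_apply, map_mul, map_mul, map_inv, mul_inv_cancel_comm]
  simp

/-- Conjugating a unipotent element by `g` gives, up to a scalar that the trace `2` forces into
`F`, a matrix over `F`. Applied to the two elementary unipotents this shows that the products of
any two entries of `g`, divided by its determinant, lie in `F`, so `g` is defined over `F` up to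
a scalar. -/
lemma mem_pglOver_of_conj (h2 : (2 : K) ≠ 0) {g : PGL(2, K)}
    (hg : ∀ u ∈ pslOver φ, g * u * g⁻¹ ∈ pglOver φ) : g ∈ pglOver φ := by
  obtain ⟨a, b, c, d, h, rfl⟩ := exists_eq_ofEntries g
  have hU : (1 : K) * 1 - 1 * 0 ≠ 0 := by simp
  have hL : (1 : K) * 1 - 0 * 1 ≠ 0 := by simp
  have hu := hg (ofEntries 1 1 0 1)
    (by simpa using ofEntries_mem_pslOver φ (a := 1) (b := 1) (c := 0) (d := 1) (by simp))
  have hl := hg (ofEntries 1 0 1 1)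
    (by simpa using ofEntries_mem_pslOver φ (a := 1) (b := 0) (c := 1) (d := 1) (by simp))
  rw [ofEntries_conj h hU, mem_pglOver φ (conj_det_ne_zero h hU)] at hu
  rw [ofEntries_conj h hL, mem_pglOver φ (conj_det_ne_zero h hL)] at hl
  obtain ⟨k, hk, hu1, hu2, hu3, hu4⟩ := hu
  obtain ⟨l, hl, hl1, hl2, hl3, hl4⟩ := hl
  set δ := a * d - b * c with hδ
  have h2F : (2 : K) ∈ φ.fieldRange := ofNat_mem φ.fieldRange 2
  have hkδ : k * δ ∈ φ.fieldRange := by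
    convert div_mem (add_mem hu1 hu4) h2F using 1
    rw [eq_div_iff h2, hδ]; ring
  have hlδ : l * δ ∈ φ.fieldRange := by
    convert div_mem (add_mem hl1 hl4) h2F using 1
    rw [eq_div_iff h2, hδ]; ring
  have hu' {x y : K} (hx : k * y ∈ φ.fieldRange) (hxy : x = y) : x / δ ∈ φ.fieldRange := by
    convert div_mem hx hkδ using 1
    rw [hxy]; field_simp
  have hl' {x y : K} (hx : l * y ∈ φ.fieldRange) (hxy : x = y) : x / δ ∈ φ.fieldRange := by
    convert div_mem hx hlδ using 1
    rw [hxy]; field_simp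
  have haa : a ^ 2 / δ ∈ φ.fieldRange := hu' hu2 (by ring)
  have hcc : c ^ 2 / δ ∈ φ.fieldRange := by
    convert neg_mem (hu' (x := -c ^ 2) hu3 (by ring)) using 1; ring
  have hac : a * c / δ ∈ φ.fieldRange := by
    convert sub_mem (one_mem _) (hu' (x := δ - a * c) hu1 (by ring)) using 1
    field_simp; ring
  have hbb : b ^ 2 / δ ∈ φ.fieldRange := by
    convert neg_mem (hl' (x := -b ^ 2) hl2 (by ring)) using 1; ring
  have hdd : d ^ 2 / δ ∈ φ.fieldRange := hl' hl3 (by ring)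
  have hbd : b * d / δ ∈ φ.fieldRange := by
    convert sub_mem (hl' (x := δ + b * d) hl1 (by ring)) (one_mem _) using 1
    field_simp; ring
  have hab : a * b / δ ∈ φ.fieldRange := by
    convert sub_mem (mul_mem haa hbd) (mul_mem hac hbb) using 1
    field_simp; rw [hδ]
  have had : a * d / δ ∈ φ.fieldRange := by
    convert sub_mem (mul_mem haa hdd) (mul_mem hac hbd) using 1
    field_simp; rw [hδ]; ring
  have hbc : b * c / δ ∈ φ.fieldRange := by
    convert sub_mem had (one_mem _) using 1
    field_simp; rw [hδ]; ring
  have hcd : c * d / δ ∈ φ.fieldRange := by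
    convert sub_mem (mul_mem hac hdd) (mul_mem hcc hbd) using 1
    field_simp; rw [hδ]; ring
  rw [mem_pglOver φ h]
  by_cases ha : a = 0
  · have hc : c ≠ 0 := fun hc ↦ h (by rw [hδ, ha, hc]; ring)
    refine ⟨c / δ, div_ne_zero hc h, ?_, ?_, ?_, ?_⟩
    · convert hac using 1; ring
    · convert hbc using 1; ring
    · convert hcc using 1; ring
    · convert hcd using 1; ring
  · refine ⟨a / δ, div_ne_zero ha h, ?_, ?_, ?_, ?_⟩
    · convert haa using 1; ring
    · convert hab using 1; ring
    · convert hac using 1; ring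
    · convert had using 1; ring

lemma normalizer_pslOver (h2 : (2 : K) ≠ 0) :
    Subgroup.normalizer (pslOver φ : Set PGL(2, K)) = pglOver φ :=
  le_antisymm (fun _ hg ↦ mem_pglOver_of_conj φ h2 fun u hu ↦ pslOver_le_pglOver φ ((hg u).1 hu))
    (pglOver_le_normalizer_pslOver φ)

lemma normalizer_pglOver (h2 : (2 : K) ≠ 0) :
    Subgroup.normalizer (pglOver φ : Set PGL(2, K)) = pglOver φ :=
  le_antisymm (fun _ hg ↦ mem_pglOver_of_conj φ h2 fun u hu ↦
    (hg u).1 (pslOver_le_pglOver φ hu)) Subgroup.le_normalizer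

end

end PGLTwo

theorem lemma3p2 {K : Type*} [Field K] [IsAlgClosed K] (p : ℕ) [CharP K p]
    (hp : p = 0 ∨ 2 < p) :
    (∀ (n : ℕ) (ζ : K), 1 < n → IsPrimitiveRoot ζ n →
      (Subgroup.normalizer (PGLTwo.cyclicGroup ζ n) : Set PGL(2, K)) =
        PGLTwo.monomialGroup K) ∧
    (∀ (n : ℕ) (ζ ξ : K), 2 < n → IsPrimitiveRoot ζ n → IsPrimitiveRoot ξ (2 * n) →
      (Subgroup.normalizer (PGLTwo.dihedralGroup ζ n) : Set PGL(2, K)) =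
        PGLTwo.dihedralGroup ξ (2 * n)) ∧
    (∀ i : K, IsPrimitiveRoot i 4 →
      (Subgroup.normalizer (PGLTwo.kleinFour K) : Set PGL(2, K)) = PGLTwo.octahedral i ∧
      (Subgroup.normalizer (PGLTwo.tetrahedral i) : Set PGL(2, K)) = PGLTwo.octahedral i ∧
      (Subgroup.normalizer (PGLTwo.octahedral i) : Set PGL(2, K)) = PGLTwo.octahedral i) ∧
    (∀ ε s : K, IsPrimitiveRoot ε 5 → s ^ 2 = 5 →
      (Subgroup.normalizer (PGLTwo.icosahedral ε s) : Set PGL(2, K)) =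
        PGLTwo.icosahedral ε s) ∧
    (∀ (F : Type*) [Field F] [Finite F] (φ : F →+* K),
      Subgroup.normalizer (PGLTwo.pslOver φ : Set PGL(2, K)) = PGLTwo.pglOver φ ∧
      Subgroup.normalizer (PGLTwo.pglOver φ : Set PGL(2, K)) = PGLTwo.pglOver φ) := by
  have h2 : (2 : K) ≠ 0 := by
    have h := (CharP.cast_eq_zero_iff K p 2).not.2 fun hd ↦ by
      rcases hp with rfl | hp
      · simp at hd
      · exact absurd (Nat.le_of_dvd two_pos hd) (by lia)
    exact_mod_cast h
  exact ⟨fun n ζ hn hζ ↦ PGLTwo.normalizer_cyclicGroup hn hζ,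
    fun n ζ ξ hn hζ hξ ↦ PGLTwo.normalizer_dihedralGroup hn hζ hξ,
    fun i hi ↦ ⟨PGLTwo.normalizer_kleinFour h2 hi, PGLTwo.normalizer_tetrahedral h2 hi,
      PGLTwo.normalizer_octahedral h2 hi⟩,
    fun ε s hε hs ↦ PGLTwo.normalizer_icosahedral h2 hε hs,
    fun F _ _ φ ↦ ⟨PGLTwo.normalizer_pslOver φ h2, PGLTwo.normalizer_pglOver φ h2⟩⟩
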